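/- Let $m$ be normalized Haar measure on the unit circle $\mathbb T=\{\lambda\in\mathbb C:|\lambda|=1\}$, let $L^1=L^1(\mathbb T,m)$ and $L^\infty=L^\infty(\mathbb T,m)$ be the usual spaces of complex functions (functions that agree $m$-almost everywhere being identified), and let $z$ denote the coordinate function $z(\lambda)=\lambda$ on $\mathbb T$. A norm $\alpha$ on $L^\infty$ is called a $\|\cdot\|_1$-dominating normalized gauge norm if $$\alpha(1)=1,\qquad \alpha(|f|)=\alpha(f)\quad\text{and}\quad \alpha(f)\ge\|f\|_1\qquad\text{for all } f\in L^\infty;$$ it is called continuous if $\lim_{m(E)\to0^+}\alpha(\chi_E)=0$. For every measurable $f:\mathbb T\to\mathbb C$ put $$\alpha(f)=\sup\{\alpha(s): s \text{ a simple function},\ 0\le s\le|f|\}\in[0,\infty],$$ let $\mathcal L^\alpha=\{f:\alpha(f)<\infty\}$, and let $L^\alpha$ be the $\alpha$-closure of $L^\infty$ in $\mathcal L^\alpha$. For $S\subseteq L^\alpha$ let $[S]^{-\alpha}$ be the closure of $S$ in $L^\alpha$ with respect to $\alpha$, and call $S$ $\alpha$-closed if $[S]^{-\alpha}=S$. The weak*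 topology on $L^\infty$ is the one it has as the dual of $L^1$ under the pairing $(f,g)\mapsto\int_{\mathbb T}fg\,dm$. **Theorem.** Let $\alpha$ be a continuous $\|\cdot\|_1$-dominating normalized gauge norm. Let $W$ be an $\alpha$-closed linear subspace of $L^\alpha$ and let $M$ be a weak*-closed linear subspace of $L^\infty$ such that $zW\subseteq W$ and $zM\subseteq M$. Then 1. $M=[M]^{-\alpha}\cap L^\infty$; 2. $W\cap M$ is weak*-closed in $L^\infty$; 3. $W=[W\cap L^\infty]^{-\alpha}$. -/

import Mathlib

open MeasureTheory
open scoped ENNReal NNReal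

noncomputable section

namespace GaugeNorm

instance circleMeasurableSpace : MeasurableSpace Circle := borel Circle

instance circleBorelSpace : BorelSpace Circle := ⟨rfl⟩

/-- Haar measure on the unit circle, normalized to have total mass `1`. -/
def m : Measure Circle := Measure.haarMeasure ⊤

instance isProbabilityMeasure_m : IsProbabilityMeasure m := ⟨Measure.haarMeasure_self⟩

/-- Measurable complex functions on the circle, modulo equality almost everywhere. -/
abbrev L0 : Type := Circle →ₘ[m] ℂ

/-- The Banach space `L^∞` of the circle. -/
abbrev LInfty : Type := Lp ℂ ∞ m

/-- `L^∞` as a set of classes of measurable functions. -/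
def linfSet : Set L0 := {f | f ∈ Lp ℂ ∞ m}

/-- The coordinate function `z` on the circle. -/
def z : L0 := ContinuousMap.toAEEqFun m ⟨fun w : Circle => (w : ℂ), by fun_prop⟩

theorem memLp_abs (f : LInfty) : MemLp (fun x => ((‖f x‖ : ℝ) : ℂ)) ∞ m :=
  (Lp.memLp f).norm.ofReal

/-- The function `|f|`, for `f` in `L^∞`. -/
def absInf (f : LInfty) : LInfty :=
  MemLp.toLp (fun x => ((‖f x‖ : ℝ) : ℂ)) (memLp_abs f)

/-- The characteristic function of a measurable set, as an element of `L^∞`. -/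
def chi {E : Set Circle} (hE : MeasurableSet E) : LInfty :=
  indicatorConstLp ∞ hE (measure_ne_top m E) (1 : ℂ)

/-- A nonnegative simple function, as an element of `L^∞`. -/
def simpleInf (s : SimpleFunc Circle ℝ≥0) : LInfty :=
  MemLp.toLp (s.map fun r : ℝ≥0 => ((r : ℝ) : ℂ)) (SimpleFunc.memLp_top _ m)

/-- `α` is a `‖·‖₁`-dominating normalized gauge norm on `L^∞`. A `Seminorm` is real valued,
subadditive and absolutely homogeneous; with `eq_zero` it is a norm. -/
structure IsDominatingGauge (α : Seminorm ℂ LInfty) : Prop where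
  eq_zero : ∀ f : LInfty, α f = 0 → f = 0
  normalized : α (chi MeasurableSet.univ) = 1
  gauge : ∀ f : LInfty, α (absInf f) = α f
  dominating : ∀ f : LInfty, ∫ x, ‖f x‖ ∂m ≤ α f

/-- Continuity of a gauge norm: `α(χ_E) → 0` as `m(E) → 0`. -/
def IsContinuousGauge (α : Seminorm ℂ LInfty) : Prop :=
  ∀ ε : ℝ, 0 < ε → ∃ δ : ℝ, 0 < δ ∧
    ∀ (E : Set Circle) (hE : MeasurableSet E), m.real E < δ → α (chi hE) < ε

/-- The extension of `α` to all measurable functions: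
`α(f) = sup {α(s) : s simple, 0 ≤ s ≤ |f|}`, with values in `[0, ∞]`. -/
def gaugeExt (α : Seminorm ℂ LInfty) (f : L0) : ℝ≥0∞ :=
  ⨆ (s : SimpleFunc Circle ℝ≥0) (_ : ∀ᵐ x ∂m, (s x : ℝ) ≤ ‖f x‖), ENNReal.ofReal (α (simpleInf s))

/-- The functions in `X` that are limits of elements of `S` with respect to `α`. -/
def closureIn (α : Seminorm ℂ LInfty) (X S : Set L0) : Set L0 :=
  {f | f ∈ X ∧ ∀ ε : ℝ≥0∞, 0 < ε → ∃ g ∈ S, gaugeExt α (f - g) < ε}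

/-- The space `𝓛^α` of all measurable `f` with `α(f) < ∞`. -/
def scriptL (α : Seminorm ℂ LInfty) : Set L0 := {f | gaugeExt α f < ∞}

/-- The space `L^α`, the `α`-closure of `L^∞` in `𝓛^α`. -/
def LAlpha (α : Seminorm ℂ LInfty) : Set L0 := closureIn α (scriptL α) linfSet

/-- The `α`-closure `[S]^{-α}` of `S` in `L^α`. -/
def alphaClosure (α : Seminorm ℂ LInfty) (S : Set L0) : Set L0 := closureIn α (LAlpha α) S

/-- `S` is an `α`-closed subset of `L^α`. -/
def IsAlphaClosed (α : Seminorm ℂ LInfty) (S : Set L0) : Prop :=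
  S ⊆ LAlpha α ∧ alphaClosure α S ⊆ S

/-- The weak* topology of `L^∞` as the dual of `L^1`: the coarsest topology for which all the
maps `f ↦ ∫ f g dm`, `g` in `L^1`, are continuous. -/
@[reducible]
def weakStar : TopologicalSpace LInfty :=
  TopologicalSpace.induced (fun (f : LInfty) (g : Lp ℂ 1 m) => ∫ x, f x * g x ∂m)
    Pi.topologicalSpace

/-- `S` is a weak*-closed subset of `L^∞`. -/
def IsWeakStarClosed (S : Set L0) : Prop :=
  S ⊆ linfSet ∧ @IsClosed LInfty weakStar {f : LInfty | (f : L0) ∈ S}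

end GaugeNorm

end

open Filter Topology
open scoped BoundedContinuousFunction Polynomial

noncomputable section

namespace GaugeNorm

/-! Two mechanisms carry the theorem: weak* separation by `L^1` functions, and outer-type
multipliers that make an integrable function bounded without leaving the closure of the polynomials
in `z`.

Separation. A gauge norm is monotone in the modulus (`isSolid_gauge`), and continuity then gives
dominated convergence (`IsSolid.tendsto_zero`). So a linear functional on `L^∞` bounded by a
continuous solid seminorm is integration against an `L^1` function, by Radon–Nikodym
(`functional_eq_integral`), and Hahn–Banach separation for such a seminorm is a weak* separation.
Applied to `α`, this makes `W ∩ L^∞` weak*-closed, and statement 2 follows by intersecting with `M`.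

Multipliers. For an integrable `F ≥ 0`, `exists_multiplier_seq` gives `q n → 1` almost everywhere
with `|q n| ≤ 1`, `q n * F` bounded, and `q n` a limit of polynomials in `L^1` with weight `1 + F`.
They come from Szegő's extremal problem: in `L^2`, the component `x` of `√k` orthogonal to `√k z
ℂ[z]` has constant modulus, and `q = x² / (c k)` with `c = ‖x‖²` satisfies `|q| = 1/k`.

For statement 1, let `g` in `L^1` annihilate `M`, and take `F = |g|`. Each `q n * g` still
annihilates `M` by invariance, and it is bounded, so it acts `α`-continuously because `α` dominates
the `L^1` norm; hence it annihilates the bounded part of the `α`-closure. Let `n → ∞`.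

For statement 3, let `f` be in `W`, and take `F = |f|`. The products `q n * f` are bounded and
converge to `f` by dominated convergence for `u ↦ α(u f)`. They lie in `W` by separation for this
same seminorm (`multiplier_mul_mem`). -/

/-! ### Solid seminorms on `L^∞` and dominated convergence. -/

theorem chi_coe {E : Set Circle} (hE : MeasurableSet E) :
    chi hE =ᵐ[m] E.indicator fun _ => (1 : ℂ) :=
  indicatorConstLp_coeFn

theorem chi_univ_coe : chi MeasurableSet.univ =ᵐ[m] fun _ => (1 : ℂ) := by
  filter_upwards [chi_coe MeasurableSet.univ] with x hx
  simpa using hx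

theorem simpleInf_coe (s : SimpleFunc Circle ℝ≥0) :
    simpleInf s =ᵐ[m] fun x => ((s x : ℝ) : ℂ) := by
  filter_upwards [MemLp.coeFn_toLp (SimpleFunc.memLp_top (s.map fun r : ℝ≥0 => ((r : ℝ) : ℂ)) m)]
    with x hx
  simpa [simpleInf] using hx

theorem absInf_coe (f : LInfty) : absInf f =ᵐ[m] fun x => ((‖f x‖ : ℝ) : ℂ) :=
  MemLp.coeFn_toLp (memLp_abs f)

theorem ae_norm_le (f : LInfty) : ∀ᵐ x ∂m, ‖f x‖ ≤ ‖f‖ := by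
  have := ae_le_eLpNormEssSup (f := f) (μ := m)
  filter_upwards [this] with x hx
  have h2 : ‖f‖ = (eLpNormEssSup f m).toReal := by
    rw [Lp.norm_def, eLpNorm_exponent_top]
  rw [h2, ← toReal_enorm]
  refine ENNReal.toReal_mono ?_ hx
  rw [← eLpNorm_exponent_top]
  exact Lp.eLpNorm_ne_top f

/-- An `L^∞` class obtained from a bounded measurable function. -/
def mkInf (f : Circle → ℂ) (hf : AEStronglyMeasurable f m) (C : ℝ) (hC : ∀ᵐ x ∂m, ‖f x‖ ≤ C) :
    LInfty :=
  MemLp.toLp f (memLp_top_of_bound hf C hC)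

theorem mkInf_coe (f : Circle → ℂ) (hf : AEStronglyMeasurable f m) (C : ℝ)
    (hC : ∀ᵐ x ∂m, ‖f x‖ ≤ C) : mkInf f hf C hC =ᵐ[m] f :=
  MemLp.coeFn_toLp _

theorem mkInf_l0 (f : L0) (C : ℝ) (hC : ∀ᵐ x ∂m, ‖f x‖ ≤ C) :
    (mkInf f f.aestronglyMeasurable C hC : L0) = f :=
  AEEqFun.ext (mkInf_coe _ _ _ _)

theorem mem_linfSet_of_bound (f : L0) (C : ℝ) (hC : ∀ᵐ x ∂m, ‖f x‖ ≤ C) : f ∈ linfSet := by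
  rw [← mkInf_l0 f C hC]
  exact (mkInf f f.aestronglyMeasurable C hC).2

theorem gauge_eq_of_norm_eq {α : Seminorm ℂ LInfty} (hα : IsDominatingGauge α) {f g : LInfty}
    (h : ∀ᵐ x ∂m, ‖f x‖ = ‖g x‖) : α f = α g := by
  rw [← hα.gauge f, ← hα.gauge g]
  congr 1
  apply Lp.ext
  filter_upwards [absInf_coe f, absInf_coe g, h] with x h1 h2 h3
  rw [h1, h2, h3]

/-- A seminorm on `L^∞` is solid if it is monotone in the modulus. -/
def IsSolid (β : Seminorm ℂ LInfty) : Prop :=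
  ∀ f g : LInfty, (∀ᵐ x ∂m, ‖f x‖ ≤ ‖g x‖) → β f ≤ β g

/-- Where `|f| ≤ |g|`, the function `|f|` is the average of `v` and its conjugate, with `v = |f| + i
√(|g|² - |f|²)` of modulus `|g|`. The gauge property and the triangle inequality conclude. -/
theorem isSolid_gauge {α : Seminorm ℂ LInfty} (hα : IsDominatingGauge α) : IsSolid α := by
  intro f g h
  let v : Circle → ℂ := fun x =>
    ((‖f x‖ : ℝ) : ℂ) + (Real.sqrt (‖g x‖ ^ 2 - ‖f x‖ ^ 2) : ℝ) * Complex.I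
  have hf := (Lp.aestronglyMeasurable f).norm
  have hg := (Lp.aestronglyMeasurable g).norm
  have hvm : AEStronglyMeasurable v m := by
    refine (Complex.continuous_ofReal.comp_aestronglyMeasurable hf).add
      ((Complex.continuous_ofReal.comp_aestronglyMeasurable
      (Real.continuous_sqrt.comp_aestronglyMeasurable ((hg.pow 2).sub (hf.pow 2)))).mul_const _)
  have hv : ∀ᵐ x ∂m, ‖v x‖ = ‖g x‖ := by
    filter_upwards [h] with x hx
    have : 0 ≤ ‖g x‖ ^ 2 - ‖f x‖ ^ 2 := by nlinarith [norm_nonneg (f x)]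
    simp only [v]
    rw [Complex.norm_add_mul_I, Real.sq_sqrt this]
    simp
  have hvb : ∀ᵐ x ∂m, ‖v x‖ ≤ ‖g‖ := by
    filter_upwards [hv, ae_norm_le g] with x h1 h2
    rw [h1]; exact h2
  let V : LInfty := mkInf v hvm _ hvb
  have hvb' : ∀ᵐ x ∂m, ‖(starRingEnd ℂ) (v x)‖ ≤ ‖g‖ := by
    filter_upwards [hvb] with x h1
    simpa using h1
  let V' : LInfty := mkInf (fun x => (starRingEnd ℂ) (v x))
    (Complex.continuous_conj.comp_aestronglyMeasurable hvm) _ hvb'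
  have e : absInf f = (1 / 2 : ℂ) • (V + V') := by
    apply Lp.ext
    filter_upwards [absInf_coe f, mkInf_coe v hvm _ hvb, mkInf_coe _ _ _ hvb',
      Lp.coeFn_smul (1 / 2 : ℂ) (V + V'), Lp.coeFn_add V V'] with x h1 h2 h3 h4 h5
    rw [h1, h4, Pi.smul_apply, h5, Pi.add_apply, h2, h3, Complex.add_conj]
    simp [v]
  have e1 : α V = α g := gauge_eq_of_norm_eq hα (by
    filter_upwards [mkInf_coe v hvm _ hvb, hv] with x h1 h2
    rw [h1, h2])
  have e2 : α V' = α g := gauge_eq_of_norm_eq hα (by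
    filter_upwards [mkInf_coe _ _ _ hvb', hv] with x h1 h2
    rw [h1, RCLike.norm_conj, h2])
  rw [← hα.gauge f, e, map_smul_eq_mul]
  have := map_add_le_add α V V'
  rw [e1, e2] at this
  norm_num
  linarith

theorem smul_chi_univ_coe (C : ℝ) :
    ((C : ℂ) • chi MeasurableSet.univ : LInfty) =ᵐ[m] fun _ => (C : ℂ) := by
  filter_upwards [Lp.coeFn_smul (C : ℂ) (chi MeasurableSet.univ), chi_univ_coe] with x h1 h2
  rw [h1, Pi.smul_apply, h2]; simp

/-- Dominated convergence for a continuous solid seminorm. -/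
theorem IsSolid.tendsto_zero {β : Seminorm ℂ LInfty} (hβ : IsSolid β) (hc : IsContinuousGauge β)
    {v : ℕ → LInfty} {C : ℝ} (hC : ∀ n, ∀ᵐ x ∂m, ‖v n x‖ ≤ C)
    (hv : ∀ᵐ x ∂m, Tendsto (fun n => v n x) atTop (𝓝 0)) :
    Tendsto (fun n => β (v n)) atTop (𝓝 0) := by
  have hC0 : 0 ≤ C := by
    obtain ⟨x, hx⟩ := (hC 0).exists
    exact (norm_nonneg _).trans hx
  have hm := tendstoInMeasure_of_tendsto_ae (μ := m) (f := fun n => (v n : Circle → ℂ))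
    (g := fun _ => 0) (fun n => Lp.aestronglyMeasurable (v n)) hv
  rw [Metric.tendsto_atTop]
  intro ε hε
  set B := β (chi MeasurableSet.univ) with hB
  have hB0 : 0 ≤ B := apply_nonneg _ _
  -- The bound is `|v n| ≤ η + C χ_E` with `E = {|v n| ≥ η}`. The thresholds make each term
  -- contribute at most `ε / 2`; the added `1`s cover `C = 0` and `B = 0`.
  obtain ⟨δ, hδ, h⟩ := hc (ε / (2 * (C + 1))) (by positivity)
  set η := ε / (2 * (B + 1)) with hη
  have hη0 : 0 < η := by positivity
  have hm1 := (ENNReal.tendsto_atTop_zero.1 (hm (ENNReal.ofReal η) (by simpa using hη0)))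
    (ENNReal.ofReal (δ / 2)) (by simpa using hδ)
  obtain ⟨n₀, hn₀⟩ := hm1
  refine ⟨n₀, fun n hn => ?_⟩
  have h1 := hn₀ n hn
  set E : Set Circle := {x | η ≤ ‖v n x‖} with hE
  have hEm : MeasurableSet E :=
    measurableSet_le measurable_const (Lp.stronglyMeasurable (v n)).norm.measurable
  have hEs : E = {x | ENNReal.ofReal η ≤ edist (v n x) 0} := by
    ext x
    simp [hE, edist_zero_right, ← ofReal_norm]
  rw [← hEs] at h1
  have h2 : m.real E < δ := by
    have : m.real E ≤ δ / 2 := ENNReal.toReal_le_of_le_ofReal (by positivity) h1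
    linarith
  have h3 := h E hEm h2
  have h4 : β (v n) ≤ β (((η : ℂ) • chi MeasurableSet.univ : LInfty) + (C : ℂ) • chi hEm) := by
    apply hβ
    filter_upwards [hC n, smul_chi_univ_coe η, chi_coe hEm, Lp.coeFn_smul (C : ℂ) (chi hEm),
      Lp.coeFn_add ((η : ℂ) • chi MeasurableSet.univ : LInfty) ((C : ℂ) • chi hEm)]
      with x g1 g2 g3 g4 g5
    rw [g5, Pi.add_apply, g2, g4, Pi.smul_apply, g3]
    by_cases hx : x ∈ E
    · simp only [Set.indicator_of_mem hx, smul_eq_mul, mul_one]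
      rw [← Complex.ofReal_add, Complex.norm_real, Real.norm_of_nonneg (by positivity)]
      linarith
    · simp only [Set.indicator_of_notMem hx, smul_eq_mul, mul_zero, add_zero]
      rw [Complex.norm_real, Real.norm_of_nonneg hη0.le]
      simp only [hE, Set.mem_ofPred_eq, not_le] at hx
      exact hx.le
  have h5 := map_add_le_add β ((η : ℂ) • chi MeasurableSet.univ : LInfty) ((C : ℂ) • chi hEm)
  rw [map_smul_eq_mul, map_smul_eq_mul, Complex.norm_real, Complex.norm_real,
    Real.norm_of_nonneg hη0.le, Real.norm_of_nonneg hC0, ← hB] at h5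
  have h6 : η * B < ε / 2 := by
    rw [hη, div_mul_eq_mul_div, div_lt_div_iff₀ (by positivity) (by positivity)]
    nlinarith
  have h7 : C * β (chi hEm) ≤ ε / 2 := by
    calc C * β (chi hEm) ≤ (C + 1) * (ε / (2 * (C + 1))) := by gcongr; linarith
      _ = ε / 2 := by field_simp
  rw [Real.dist_eq, sub_zero, abs_of_nonneg (apply_nonneg _ _)]
  linarith

/-! ### The extension of `α` to measurable functions. -/

variable {α : Seminorm ℂ LInfty}

theorem gaugeExt_mono (α : Seminorm ℂ LInfty) {f g : L0} (h : ∀ᵐ x ∂m, ‖f x‖ ≤ ‖g x‖) :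
    gaugeExt α f ≤ gaugeExt α g := by
  refine iSup₂_le fun s hs => ?_
  refine le_iSup₂_of_le s ?_ le_rfl
  filter_upwards [hs, h] with x h1 h2 using h1.trans h2

theorem exists_simpleFunc_tendsto (f : LInfty) :
    ∃ s : ℕ → SimpleFunc Circle ℝ≥0, (∀ n x, (s n x : ℝ) ≤ ‖f x‖) ∧
      ∀ x, Tendsto (fun n => (s n x : ℝ)) atTop (𝓝 ‖f x‖) := by
  have hf : Measurable fun x => ‖f x‖ₑ := (Lp.stronglyMeasurable f).enorm
  have hle : ∀ n x, SimpleFunc.eapprox (fun x => ‖f x‖ₑ) n x ≤ ‖f x‖ₑ := fun n x => by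
    rw [← SimpleFunc.iSup_eapprox_apply hf x]
    exact le_iSup (fun n => SimpleFunc.eapprox (fun x => ‖f x‖ₑ) n x) n
  refine ⟨fun n => (SimpleFunc.eapprox (fun x => ‖f x‖ₑ) n).map ENNReal.toNNReal,
    fun n x => ?_, fun x => ?_⟩
  · have := ENNReal.toReal_mono enorm_ne_top (hle n x)
    rwa [toReal_enorm] at this
  · have := (ENNReal.tendsto_toReal (enorm_ne_top (x := f x))).comp (SimpleFunc.tendsto_eapprox hf x)
    rwa [toReal_enorm] at this

/-- Solidity bounds the supremum by `α f`. Conversely, simple functions below `|f|` converge to it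
pointwise, hence in `α` by dominated convergence. -/
theorem gaugeExt_coe (hα : IsDominatingGauge α) (hc : IsContinuousGauge α) (f : LInfty) :
    gaugeExt α f = ENNReal.ofReal (α f) := by
  apply le_antisymm
  · refine iSup₂_le fun s hs => ENNReal.ofReal_le_ofReal (isSolid_gauge hα _ _ ?_)
    filter_upwards [hs, simpleInf_coe s] with x h1 h2
    rw [h2]
    simpa using h1
  · obtain ⟨s, h1, h2⟩ := exists_simpleFunc_tendsto f
    have hcoe : ∀ᵐ x ∂m, ∀ n, (absInf f - simpleInf (s n) : LInfty) x
        = ((‖f x‖ - (s n x : ℝ) : ℝ) : ℂ) := by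
      rw [ae_all_iff]
      intro n
      filter_upwards [Lp.coeFn_sub (absInf f) (simpleInf (s n)), absInf_coe f,
        simpleInf_coe (s n)] with x g1 g2 g3
      rw [g1, Pi.sub_apply, g2, g3]; push_cast; rfl
    have hlim : Tendsto (fun n => α (absInf f - simpleInf (s n))) atTop (𝓝 0) := by
      refine (isSolid_gauge hα).tendsto_zero hc (C := ‖f‖) (fun n => ?_) ?_
      · filter_upwards [hcoe, ae_norm_le f] with x g1 g2
        rw [g1 n, Complex.norm_real, Real.norm_of_nonneg (sub_nonneg.2 (h1 n x))]
        linarith [(s n x).coe_nonneg]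
      · filter_upwards [hcoe] with x g1
        simp_rw [g1]
        have := (h2 x).const_sub ‖f x‖
        rw [sub_self] at this
        exact (Complex.continuous_ofReal.tendsto' 0 0 (by simp)).comp this
    refine ENNReal.le_of_forall_pos_le_add fun ε hε _ => ?_
    obtain ⟨n, hn⟩ := (hlim.eventually (gt_mem_nhds (NNReal.coe_pos.2 hε))).exists
    have h3 : α f ≤ α (simpleInf (s n)) + ε := by
      rw [← hα.gauge f]
      have := map_add_le_add α (absInf f - simpleInf (s n)) (simpleInf (s n))
      rw [sub_add_cancel] at this
      linarith
    refine (ENNReal.ofReal_le_ofReal h3).trans ?_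
    rw [ENNReal.ofReal_add (apply_nonneg _ _) ε.coe_nonneg, ENNReal.ofReal_coe_nnreal]
    gcongr
    exact le_iSup₂_of_le (s n) (Eventually.of_forall (h1 n)) le_rfl

theorem ofReal_gauge_le_gaugeExt (hα : IsDominatingGauge α) (hc : IsContinuousGauge α)
    {u : LInfty} {f : L0} (h : ∀ᵐ x ∂m, ‖u x‖ ≤ ‖f x‖) : ENNReal.ofReal (α u) ≤ gaugeExt α f := by
  rw [← gaugeExt_coe hα hc]
  exact gaugeExt_mono α h

/-- Riesz decomposition: if `s ≤ |f + g|`, then `s` is the sum of `min s |f|` and a remainder at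
most `|g|`. The first piece need not be simple, so the comparison goes through `gaugeExt_coe`. -/
theorem gaugeExt_add_le (hα : IsDominatingGauge α) (hc : IsContinuousGauge α) (f g : L0) :
    gaugeExt α (f + g) ≤ gaugeExt α f + gaugeExt α g := by
  refine iSup₂_le fun s hs => ?_
  have hsm : AEStronglyMeasurable (fun x => (s x : ℝ)) m := by
    exact (NNReal.continuous_coe.comp_stronglyMeasurable s.stronglyMeasurable).aestronglyMeasurable
  have hum : AEStronglyMeasurable (fun x => ((min (s x : ℝ) ‖f x‖ : ℝ) : ℂ)) m :=
    Complex.continuous_ofReal.comp_aestronglyMeasurable (hsm.inf f.aestronglyMeasurable.norm)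
  have hub : ∀ᵐ x ∂m, ‖((min (s x : ℝ) ‖f x‖ : ℝ) : ℂ)‖ ≤ ‖simpleInf s‖ := by
    filter_upwards [ae_norm_le (simpleInf s), simpleInf_coe s] with x h1 h2
    rw [h2] at h1
    rw [Complex.norm_real, Real.norm_of_nonneg (le_min (s x).coe_nonneg (norm_nonneg _))]
    refine (min_le_left _ _).trans ?_
    simpa using h1
  let u := mkInf _ hum _ hub
  have hu := mkInf_coe _ hum _ hub
  have h1 : ENNReal.ofReal (α u) ≤ gaugeExt α f := by
    refine ofReal_gauge_le_gaugeExt hα hc ?_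
    filter_upwards [hu] with x h1
    rw [h1, Complex.norm_real, Real.norm_of_nonneg (le_min (s x).coe_nonneg (norm_nonneg _))]
    exact min_le_right _ _
  have h2 : ENNReal.ofReal (α (simpleInf s - u)) ≤ gaugeExt α g := by
    refine ofReal_gauge_le_gaugeExt hα hc ?_
    filter_upwards [hu, simpleInf_coe s, Lp.coeFn_sub (simpleInf s) u, hs, AEEqFun.coeFn_add f g]
      with x h1 h2 h3 h4 h5
    rw [h3, Pi.sub_apply, h1, h2, ← Complex.ofReal_sub, Complex.norm_real,
      Real.norm_of_nonneg (sub_nonneg.2 (min_le_left _ _))]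
    rw [h5, Pi.add_apply] at h4
    have := norm_add_le (f x) (g x)
    rcases min_cases (s x : ℝ) ‖f x‖ with h | h
    · rw [h.1, sub_self]; exact norm_nonneg _
    · rw [h.1]; linarith
  have h3 := map_add_le_add α u (simpleInf s - u)
  rw [add_sub_cancel] at h3
  calc ENNReal.ofReal (α (simpleInf s)) ≤ ENNReal.ofReal (α u + α (simpleInf s - u)) :=
        ENNReal.ofReal_le_ofReal h3
    _ = ENNReal.ofReal (α u) + ENNReal.ofReal (α (simpleInf s - u)) :=
        ENNReal.ofReal_add (apply_nonneg _ _) (apply_nonneg _ _)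
    _ ≤ _ := add_le_add h1 h2

theorem gaugeExt_zero (hα : IsDominatingGauge α) (hc : IsContinuousGauge α) :
    gaugeExt α 0 = 0 := by
  have := gaugeExt_coe hα hc 0
  simpa using this

theorem gaugeExt_le_mul (hα : IsDominatingGauge α) (hc : IsContinuousGauge α) {f g : L0}
    {C : ℝ≥0} (h : ∀ᵐ x ∂m, ‖g x‖ ≤ C * ‖f x‖) : gaugeExt α g ≤ C * gaugeExt α f := by
  rcases eq_or_ne C 0 with rfl | hC
  · have : gaugeExt α g ≤ gaugeExt α 0 := gaugeExt_mono α (by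
      filter_upwards [h] with x hx
      have : ‖g x‖ ≤ 0 := by simpa using hx
      exact this.trans (norm_nonneg _))
    rw [gaugeExt_zero hα hc] at this
    exact this.trans zero_le
  refine iSup₂_le fun s hs => ?_
  let t : SimpleFunc Circle ℝ≥0 := s.map fun r => C⁻¹ * r
  have ht : (simpleInf s : LInfty) = ((C : ℝ) : ℂ) • simpleInf t := by
    apply Lp.ext
    filter_upwards [simpleInf_coe s, simpleInf_coe t,
      Lp.coeFn_smul ((C : ℝ) : ℂ) (simpleInf t)] with x h1 h2 h3
    rw [h1, h3, Pi.smul_apply, h2]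
    have : (C : ℂ) ≠ 0 := by exact_mod_cast hC
    simp [t, this]
  rw [ht, map_smul_eq_mul, ENNReal.ofReal_mul (norm_nonneg _)]
  have e : ENNReal.ofReal ‖((C : ℝ) : ℂ)‖ = C := by simp
  rw [e]
  gcongr
  refine le_iSup₂_of_le t ?_ le_rfl
  filter_upwards [hs, h] with x h1 h2
  have hC' : (0 : ℝ) < C := by positivity
  simp only [t, SimpleFunc.map_apply, NNReal.coe_mul, NNReal.coe_inv]
  rw [inv_mul_le_iff₀ hC']
  linarith

theorem lintegral_le_gaugeExt (hα : IsDominatingGauge α) (f : L0) :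
    ∫⁻ x, ‖f x‖ₑ ∂m ≤ gaugeExt α f := by
  rw [lintegral_eq_nnreal]
  refine iSup₂_le fun s hs => ?_
  refine le_iSup₂_of_le s (Eventually.of_forall fun x => ?_) ?_
  · have := hs x
    rw [enorm_eq_nnnorm, ENNReal.coe_le_coe] at this
    exact_mod_cast this
  · rw [← SimpleFunc.lintegral_eq_lintegral]
    have h1 : ∫⁻ x, ‖simpleInf s x‖ₑ ∂m = ∫⁻ x, (s.map ((↑) : ℝ≥0 → ℝ≥0∞)) x ∂m := by
      refine lintegral_congr_ae ?_
      filter_upwards [simpleInf_coe s] with x hx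
      rw [hx]
      simp [enorm_eq_nnnorm]
    rw [← h1, ← ofReal_integral_norm_eq_lintegral_enorm]
    · exact ENNReal.ofReal_le_ofReal (hα.dominating _)
    · exact (Lp.memLp (simpleInf s)).integrable le_top

theorem gaugeExt_lt_top {f : L0} (hf : f ∈ LAlpha α) : gaugeExt α f < ∞ :=
  hf.1

theorem linfSet_subset_LAlpha (hα : IsDominatingGauge α) (hc : IsContinuousGauge α) :
    linfSet ⊆ LAlpha α := by
  intro f hf
  refine ⟨?_, fun ε hε => ⟨f, hf, ?_⟩⟩
  · change gaugeExt α ((⟨f, hf⟩ : LInfty) : L0) < ∞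
    rw [gaugeExt_coe hα hc]
    exact ENNReal.ofReal_lt_top
  · rw [sub_self, gaugeExt_zero hα hc]
    exact hε

theorem integrable_of_gaugeExt_lt_top (hα : IsDominatingGauge α) {f : L0}
    (hf : gaugeExt α f < ∞) : Integrable f m :=
  ⟨f.aestronglyMeasurable, (lintegral_le_gaugeExt hα f).trans_lt hf⟩

/-! ### Multiplication by bounded functions and the seminorm `u ↦ α(u f)`. -/

theorem mul_coe_norm_le (u : LInfty) (f : L0) :
    ∀ᵐ x ∂m, ‖((u : L0) * f : L0) x‖ ≤ ‖u‖₊ * ‖f x‖ := by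
  filter_upwards [AEEqFun.coeFn_mul (u : L0) f, ae_norm_le u] with x h1 h2
  rw [h1, Pi.mul_apply, norm_mul]
  gcongr
  exact h2

theorem L0.sub_mul' (f g h : L0) : (f - g) * h = f * h - g * h := by
  apply AEEqFun.ext
  filter_upwards [AEEqFun.coeFn_mul (f - g) h, AEEqFun.coeFn_sub f g, AEEqFun.coeFn_mul f h,
    AEEqFun.coeFn_mul g h, AEEqFun.coeFn_sub (f * h) (g * h)] with x h1 h2 h3 h4 h5
  rw [h1, h5, Pi.mul_apply, h2, Pi.sub_apply, Pi.sub_apply, h3, h4]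
  simp [sub_mul]

theorem L0.add_mul' (f g h : L0) : (f + g) * h = f * h + g * h := by
  apply AEEqFun.ext
  filter_upwards [AEEqFun.coeFn_mul (f + g) h, AEEqFun.coeFn_add f g, AEEqFun.coeFn_mul f h,
    AEEqFun.coeFn_mul g h, AEEqFun.coeFn_add (f * h) (g * h)] with x h1 h2 h3 h4 h5
  rw [h1, h5, Pi.mul_apply, h2, Pi.add_apply, Pi.add_apply, h3, h4]
  simp [add_mul]

theorem L0.smul_mul' (c : ℂ) (f h : L0) : (c • f) * h = c • (f * h) := by
  apply AEEqFun.ext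
  filter_upwards [AEEqFun.coeFn_mul (c • f) h, AEEqFun.coeFn_smul c f, AEEqFun.coeFn_mul f h,
    AEEqFun.coeFn_smul c (f * h)] with x h1 h2 h3 h4
  rw [h1, h4, Pi.mul_apply, h2, Pi.smul_apply, Pi.smul_apply, h3]
  simp [mul_assoc]

theorem mul_mem_LAlpha (hα : IsDominatingGauge α) (hc : IsContinuousGauge α) (u : LInfty)
    {f : L0} (hf : f ∈ LAlpha α) : (u : L0) * f ∈ LAlpha α := by
  have key : ∀ g : L0, gaugeExt α ((u : L0) * g) ≤ ‖u‖₊ * gaugeExt α g := fun g =>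
    gaugeExt_le_mul hα hc (mul_coe_norm_le u g)
  refine ⟨(key f).trans_lt (ENNReal.mul_lt_top ENNReal.coe_lt_top hf.1), fun ε hε => ?_⟩
  obtain ⟨δ, hδ, hδ'⟩ : ∃ δ : ℝ≥0∞, 0 < δ ∧ ‖u‖₊ * δ < ε := by
    have : Tendsto (fun δ : ℝ≥0∞ => ‖u‖₊ * δ) (𝓝[>] 0) (𝓝 (‖u‖₊ * 0)) :=
      (ENNReal.Tendsto.const_mul tendsto_id (Or.inr ENNReal.coe_ne_top)).mono_left
        nhdsWithin_le_nhds
    rw [mul_zero] at this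
    obtain ⟨δ, h1, h2⟩ := ((this.eventually (gt_mem_nhds hε)).and self_mem_nhdsWithin).exists
    exact ⟨δ, h2, h1⟩
  obtain ⟨g, hg, hfg⟩ := hf.2 δ hδ
  refine ⟨(u : L0) * g, ?_, ?_⟩
  · refine mem_linfSet_of_bound _ (‖u‖₊ * ‖(⟨g, hg⟩ : LInfty)‖) ?_
    filter_upwards [mul_coe_norm_le u g, ae_norm_le (⟨g, hg⟩ : LInfty)] with x h1 h2
    refine h1.trans ?_
    gcongr
  · have e : (u : L0) * f - (u : L0) * g = (u : L0) * (f - g) := by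
      rw [mul_comm _ f, mul_comm _ g, ← L0.sub_mul', mul_comm]
    rw [e]
    exact (key _).trans_lt ((by gcongr : _ ≤ (‖u‖₊ : ℝ≥0∞) * δ).trans_lt hδ')

/-- The seminorm `u ↦ α(u f)` on `L^∞`, for `f` with `α(f) < ∞`. -/
def mulSeminorm (hα : IsDominatingGauge α) (hc : IsContinuousGauge α) (f : L0)
    (hf : gaugeExt α f < ∞) : Seminorm ℂ LInfty :=
  have fin : ∀ u : LInfty, gaugeExt α ((u : L0) * f) ≠ ∞ := fun u =>
    ((gaugeExt_le_mul hα hc (mul_coe_norm_le u f)).trans_lt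
      (ENNReal.mul_lt_top ENNReal.coe_lt_top hf)).ne
  Seminorm.ofSMulLE (fun u => (gaugeExt α ((u : L0) * f)).toReal)
    (by
      have : ((0 : LInfty) : L0) * f = 0 := by
        have h := L0.sub_mul' 0 0 f
        simpa using h
      simp only [this, gaugeExt_zero hα hc, ENNReal.toReal_zero])
    (fun u v => by
      rw [← ENNReal.toReal_add (fin u) (fin v)]
      refine ENNReal.toReal_mono (ENNReal.add_ne_top.2 ⟨fin u, fin v⟩) ?_
      have : ((u + v : LInfty) : L0) * f = (u : L0) * f + (v : L0) * f := L0.add_mul' _ _ _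
      rw [this]
      exact gaugeExt_add_le hα hc _ _)
    (fun c u => by
      have e : ‖c‖ * (gaugeExt α ((u : L0) * f)).toReal
          = (‖c‖₊ * gaugeExt α ((u : L0) * f)).toReal := by simp
      rw [e]
      refine ENNReal.toReal_mono (ENNReal.mul_ne_top ENNReal.coe_ne_top (fin u)) ?_
      refine gaugeExt_le_mul hα hc ?_
      have : ((c • u : LInfty) : L0) * f = c • ((u : L0) * f) := L0.smul_mul' _ _ _
      rw [this]
      filter_upwards [AEEqFun.coeFn_smul c ((u : L0) * f)] with x hx
      rw [hx, Pi.smul_apply, norm_smul]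
      rfl)

theorem ofReal_mulSeminorm (hα : IsDominatingGauge α) (hc : IsContinuousGauge α) (f : L0)
    (hf : gaugeExt α f < ∞) (u : LInfty) :
    ENNReal.ofReal (mulSeminorm hα hc f hf u) = gaugeExt α ((u : L0) * f) :=
  ENNReal.ofReal_toReal ((gaugeExt_le_mul hα hc (mul_coe_norm_le u f)).trans_lt
    (ENNReal.mul_lt_top ENNReal.coe_lt_top hf)).ne

theorem isSolid_mulSeminorm (hα : IsDominatingGauge α) (hc : IsContinuousGauge α) (f : L0)
    (hf : gaugeExt α f < ∞) : IsSolid (mulSeminorm hα hc f hf) := by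
  intro u v huv
  rw [← ENNReal.ofReal_le_ofReal_iff (apply_nonneg _ _), ofReal_mulSeminorm, ofReal_mulSeminorm]
  refine gaugeExt_mono α ?_
  filter_upwards [AEEqFun.coeFn_mul (u : L0) f, AEEqFun.coeFn_mul (v : L0) f, huv] with x h1 h2 h3
  rw [h1, h2, Pi.mul_apply, Pi.mul_apply, norm_mul, norm_mul]
  gcongr

/-- Membership in `L^α` supplies a bounded `g` near `f`. Then `χ_E (f - g)` is small uniformly in
`E`, while `χ_E g` is controlled by the continuity of `α`. -/
theorem isContinuousGauge_mulSeminorm (hα : IsDominatingGauge α) (hc : IsContinuousGauge α)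
    {f : L0} (hf : f ∈ LAlpha α) : IsContinuousGauge (mulSeminorm hα hc f (gaugeExt_lt_top hf)) := by
  intro ε hε
  obtain ⟨g, hg, hfg⟩ := hf.2 (ENNReal.ofReal (ε / 2)) (by simpa using hε)
  set G : LInfty := ⟨g, hg⟩
  obtain ⟨δ, hδ, h⟩ := hc (ε / (2 * (‖G‖ + 1))) (by positivity)
  refine ⟨δ, hδ, fun E hE hEδ => ?_⟩
  rw [← ENNReal.ofReal_lt_ofReal_iff hε, ofReal_mulSeminorm]
  have e : (chi hE : L0) * f = (chi hE : L0) * (f - g) + (chi hE : L0) * g := by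
    rw [mul_comm _ (f - g), L0.sub_mul', mul_comm f, mul_comm g, sub_add_cancel]
  have h1 : gaugeExt α ((chi hE : L0) * (f - g)) ≤ gaugeExt α (f - g) := by
    refine gaugeExt_mono α ?_
    filter_upwards [AEEqFun.coeFn_mul (chi hE : L0) (f - g), chi_coe hE] with x h1 h2
    rw [h1, Pi.mul_apply, h2, norm_mul]
    refine mul_le_of_le_one_left (norm_nonneg _) ?_
    by_cases hx : x ∈ E <;> simp [hx]
  have h2 : gaugeExt α ((chi hE : L0) * g) ≤ ‖G‖₊ * gaugeExt α (chi hE) := by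
    rw [mul_comm]
    exact gaugeExt_le_mul hα hc (mul_coe_norm_le G _)
  have h3 : (‖G‖₊ : ℝ≥0∞) * gaugeExt α (chi hE) ≤ ENNReal.ofReal (ε / 2) := by
    rw [gaugeExt_coe hα hc, ← ENNReal.ofReal_coe_nnreal, ← ENNReal.ofReal_mul (by positivity)]
    refine ENNReal.ofReal_le_ofReal ?_
    calc (‖G‖₊ : ℝ) * α (chi hE) ≤ (‖G‖ + 1) * (ε / (2 * (‖G‖ + 1))) := by
          have := (h E hE hEδ).le
          rw [coe_nnnorm]
          gcongr
          linarith
      _ = ε / 2 := by field_simp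
  rw [e]
  calc _ ≤ _ := gaugeExt_add_le hα hc _ _
    _ < ENNReal.ofReal (ε / 2) + ENNReal.ofReal (ε / 2) :=
        ENNReal.add_lt_add_of_lt_of_le (h2.trans_lt (h3.trans_lt ENNReal.ofReal_lt_top)).ne
          (h1.trans_lt hfg) (h2.trans h3)
    _ = ENNReal.ofReal ε := by
        rw [← ENNReal.ofReal_add (by positivity) (by positivity), add_halves]

/-! ### Hahn–Banach separation and the weak* topology. -/

theorem exists_dual_of_notMem_closed {E : Type*} [AddCommGroup E] [Module ℂ E]
    [TopologicalSpace E] [IsTopologicalAddGroup E] [ContinuousSMul ℂ E] [Module ℝ E]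
    [IsScalarTower ℝ ℂ E] [LocallyConvexSpace ℝ E] (N : Submodule ℂ E)
    (hN : IsClosed (N : Set E)) {f : E} (hf : f ∉ N) :
    ∃ φ : StrongDual ℂ E, (∀ u ∈ N, φ u = 0) ∧ φ f ≠ 0 := by
  have hconv : Convex ℝ (N : Set E) := (N.restrictScalars ℝ).convex
  obtain ⟨φ, r, h1, h2⟩ := RCLike.geometric_hahn_banach_point_closed (𝕜 := ℂ) hconv hN hf
  have h0 : r < 0 := by simpa using h2 0 N.zero_mem
  have hz : ∀ u ∈ N, φ u = 0 := by
    intro u hu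
    by_contra hne
    -- This multiple of `u` lies in `N` and `φ` sends it to `r`, against the strict bound `r < Re φ`
    -- on `N`.
    have := h2 (((r : ℂ) / φ u) • u) (N.smul_mem _ hu)
    rw [map_smul, smul_eq_mul, div_mul_cancel₀ _ hne] at this
    simp at this
  refine ⟨φ, hz, fun h => ?_⟩
  rw [h] at h1
  simp at h1
  linarith

/-- Hahn–Banach in the topology of `β` itself: the distance hypothesis keeps `f` out of the
`β`-closure of `N`, and `C` is the operator norm of the separating functional. -/
theorem exists_functional_of_seminorm {E : Type*} [AddCommGroup E] [Module ℂ E]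
    (β : Seminorm ℂ E) (N : Submodule ℂ E) {f : E} {ε : ℝ} (hε : 0 < ε)
    (hf : ∀ u ∈ N, ε ≤ β (f - u)) :
    ∃ (φ : E →ₗ[ℂ] ℂ) (C : ℝ), (∀ u, ‖φ u‖ ≤ C * β u) ∧ (∀ u ∈ N, φ u = 0) ∧ φ f ≠ 0 := by
  let : SeminormedAddCommGroup E := β.toAddGroupSeminorm.toSeminormedAddCommGroup
  let : NormedSpace ℂ E := ⟨fun c u => (map_smul_eq_mul β c u).le⟩
  let : NormedSpace ℝ E := NormedSpace.restrictScalars ℝ ℂ E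
  have hnorm : ∀ u : E, ‖u‖ = β u := fun u => rfl
  have hf' : f ∉ N.topologicalClosure := by
    intro h
    obtain ⟨u, hu, hfu⟩ := Metric.mem_closure_iff.1 h ε hε
    rw [dist_eq_norm, hnorm] at hfu
    exact absurd (hf u hu) (not_le.2 hfu)
  obtain ⟨φ, h1, h2⟩ := exists_dual_of_notMem_closed N.topologicalClosure
    N.isClosed_topologicalClosure hf'
  exact ⟨φ.toLinearMap, ‖φ‖, fun u => φ.le_opNorm u,
    fun u hu => h1 u (N.le_topologicalClosure hu), h2⟩

theorem integrable_mul_L1 (u : LInfty) {g : Circle → ℂ} (hg : Integrable g m) :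
    Integrable (fun x => u x * g x) m :=
  hg.bdd_mul (Lp.aestronglyMeasurable u) (ae_norm_le u)

/-- The bilinear pairing between `L^∞` and `L^1`. -/
def pairing : LInfty →ₗ[ℂ] Lp ℂ 1 m →ₗ[ℂ] ℂ :=
  LinearMap.mk₂ ℂ (fun f g => ∫ x, f x * g x ∂m)
    (fun f f' g => by
      rw [← integral_add (integrable_mul_L1 _ (L1.integrable_coeFn g))
        (integrable_mul_L1 _ (L1.integrable_coeFn g))]
      refine integral_congr_ae ?_
      filter_upwards [Lp.coeFn_add f f'] with x hx
      rw [hx, Pi.add_apply, add_mul])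
    (fun c f g => by
      rw [smul_eq_mul, ← integral_const_mul]
      refine integral_congr_ae ?_
      filter_upwards [Lp.coeFn_smul c f] with x hx
      rw [hx, Pi.smul_apply, smul_eq_mul, mul_assoc])
    (fun f g g' => by
      rw [← integral_add (integrable_mul_L1 _ (L1.integrable_coeFn g))
        (integrable_mul_L1 _ (L1.integrable_coeFn g'))]
      refine integral_congr_ae ?_
      filter_upwards [Lp.coeFn_add g g'] with x hx
      rw [hx, Pi.add_apply, mul_add])
    (fun c f g => by
      rw [smul_eq_mul, ← integral_const_mul]
      refine integral_congr_ae ?_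
      filter_upwards [Lp.coeFn_smul c g] with x hx
      rw [hx, Pi.smul_apply, smul_eq_mul, mul_left_comm])

/-- The weak* topology is the weak topology of `pairing`, so it is locally convex and each of its
continuous functionals is pairing with an element of `L^1`. -/
theorem exists_annihilator_of_weakStarClosed (N : Submodule ℂ LInfty)
    (hN : @IsClosed LInfty weakStar N) {f : LInfty} (hf : f ∉ N) :
    ∃ g : Circle → ℂ, Integrable g m ∧ (∀ u ∈ N, ∫ x, u x * g x ∂m = 0) ∧
      ∫ x, f x * g x ∂m ≠ 0 := by
  let : Module ℝ (WeakBilin pairing) := inferInstanceAs (Module ℝ LInfty)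
  have : IsScalarTower ℝ ℂ (WeakBilin pairing) := inferInstanceAs (IsScalarTower ℝ ℂ LInfty)
  let N' : Submodule ℂ (WeakBilin pairing) := N
  have hN' : IsClosed (N' : Set (WeakBilin pairing)) := hN
  obtain ⟨φ, h1, h2⟩ := exists_dual_of_notMem_closed N' hN' hf
  obtain ⟨g, rfl⟩ := LinearMap.dualEmbedding_surjective pairing φ
  exact ⟨g, L1.integrable_coeFn g, h1, h2⟩

theorem isClosed_annihilator (g : Circle → ℂ) (hg : Integrable g m) :
    @IsClosed LInfty weakStar {u : LInfty | ∫ x, u x * g x ∂m = 0} := by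
  let := weakStar
  have hc : Continuous fun u : LInfty => ∫ x, u x * (hg.toL1 g) x ∂m :=
    (continuous_apply (A := fun _ : Lp ℂ 1 m => ℂ) (hg.toL1 g)).comp
      (continuous_induced_dom (f := fun (f : LInfty) (g : Lp ℂ 1 m) => ∫ x, f x * g x ∂m))
  have e : {u : LInfty | ∫ x, u x * g x ∂m = 0}
      = {u : LInfty | ∫ x, u x * (hg.toL1 g) x ∂m = 0} := by
    ext u
    have : ∫ x, u x * (hg.toL1 g) x ∂m = ∫ x, u x * g x ∂m := by
      refine integral_congr_ae ?_
      filter_upwards [hg.coeFn_toL1] with x hx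
      rw [hx]
    rw [Set.mem_ofPred_eq, Set.mem_ofPred_eq, this]
  rw [e]
  exact isClosed_eq hc continuous_const

/-! ### Functionals dominated by a continuous solid seminorm are `L^1` functions. -/

theorem chi_congr {E F : Set Circle} (hE : MeasurableSet E) (hF : MeasurableSet F) (h : E = F) :
    chi hE = chi hF := by
  subst h; rfl

theorem chi_union {E F : Set Circle} (hE : MeasurableSet E) (hF : MeasurableSet F)
    (h : Disjoint E F) : chi (hE.union hF) = chi hE + chi hF :=
  indicatorConstLp_disjoint_union hE hF (measure_ne_top m E) (measure_ne_top m F) h 1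

theorem chi_eq_zero {E : Set Circle} (hE : MeasurableSet E) (h : m E = 0) : chi hE = 0 := by
  apply Lp.ext
  filter_upwards [chi_coe hE, Lp.coeFn_zero ℂ ∞ m, measure_eq_zero_iff_ae_notMem.1 h]
    with x h1 h2 h3
  rw [h1, h2, Set.indicator_of_notMem h3]
  rfl

theorem chi_biUnion {ι : Type*} {E : ι → Set Circle} (hE : ∀ i, MeasurableSet (E i))
    (hd : Pairwise (Function.onFun Disjoint E)) (s : Finset ι) :
    chi (s.measurableSet_biUnion fun i _ => hE i) = ∑ i ∈ s, chi (hE i) := by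
  classical
  induction s using Finset.induction_on with
  | empty => simpa using chi_eq_zero (E := ⋃ i ∈ (∅ : Finset ι), E i) (by simp) (by simp)
  | insert a s ha ih =>
    rw [Finset.sum_insert ha, ← ih, ← chi_union]
    · exact chi_congr _ _ (by simp)
    · rw [Set.disjoint_iUnion₂_right]
      exact fun i hi => hd (by rintro rfl; exact ha hi)

/-- What a finite partial union leaves over has small measure, so its characteristic function has
small `β` and hence small image under `φ`. -/
theorem hasSum_functional_chi {β : Seminorm ℂ LInfty} (hc : IsContinuousGauge β)
    {φ : LInfty →ₗ[ℂ] ℂ} {C : ℝ} (hφ : ∀ u, ‖φ u‖ ≤ C * β u) {E : ℕ → Set Circle}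
    (hE : ∀ i, MeasurableSet (E i)) (hd : Pairwise (Function.onFun Disjoint E)) :
    HasSum (fun i => φ (chi (hE i))) (φ (chi (MeasurableSet.iUnion hE))) := by
  have hm : HasSum (fun i => m.real (E i)) (m.real (⋃ i, E i)) := by
    have hsum : m (⋃ i, E i) = ∑' i, m (E i) := measure_iUnion hd hE
    have h1 : ∑' i, m (E i) ≠ ∞ := hsum ▸ measure_ne_top m _
    rw [Measure.real, hsum, ENNReal.tsum_toReal_eq fun i => measure_ne_top m _]
    exact (ENNReal.hasSum_toReal h1)
  rw [HasSum, Metric.tendsto_nhds]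
  intro ε hε
  obtain ⟨δ, hδ, h⟩ := hc (ε / (|C| + 1)) (by positivity)
  have hm' := Metric.tendsto_nhds.1 hm δ hδ
  filter_upwards [hm'] with s hs
  have hB : MeasurableSet (⋃ i ∈ s, E i) := s.measurableSet_biUnion fun i _ => hE i
  have hsub : (⋃ i ∈ s, E i) ⊆ ⋃ i, E i := Set.iUnion₂_subset_iUnion _ _
  have hR : MeasurableSet ((⋃ i, E i) \ ⋃ i ∈ s, E i) := (MeasurableSet.iUnion hE).diff hB
  have e1 : chi (MeasurableSet.iUnion hE) = chi hB + chi hR := by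
    rw [← chi_union _ _ Set.disjoint_sdiff_right]
    exact chi_congr _ _ (by rw [Set.union_sdiff_cancel hsub])
  have e2 : m.real ((⋃ i, E i) \ ⋃ i ∈ s, E i) = m.real (⋃ i, E i) - ∑ i ∈ s, m.real (E i) := by
    rw [measureReal_sdiff hsub hB, measureReal_biUnion_finset (fun i _ j _ hij => hd hij)
      (fun i _ => hE i)]
  have h3 : m.real ((⋃ i, E i) \ ⋃ i ∈ s, E i) < δ := by
    rw [e2]
    rw [dist_comm, Real.dist_eq] at hs
    exact (le_abs_self _).trans_lt hs
  rw [e1, chi_biUnion hE hd, map_add, map_sum, dist_eq_norm, sub_add_cancel_left, norm_neg]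
  calc ‖φ (chi hR)‖ ≤ C * β (chi hR) := hφ _
    _ ≤ |C| * β (chi hR) := by gcongr; exact le_abs_self C
    _ ≤ |C| * (ε / (|C| + 1)) := by gcongr; exact (h _ hR h3).le
    _ < (|C| + 1) * (ε / (|C| + 1)) := by gcongr; linarith
    _ = ε := by field_simp

open Classical in
/-- The complex measure `E ↦ φ(χ_E)`. -/
def functionalMeasure {β : Seminorm ℂ LInfty} (hc : IsContinuousGauge β)
    {φ : LInfty →ₗ[ℂ] ℂ} {C : ℝ} (hφ : ∀ u, ‖φ u‖ ≤ C * β u) : ComplexMeasure Circle where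
  measureOf' E := if hE : MeasurableSet E then φ (chi hE) else 0
  empty' := by
    rw [dif_pos MeasurableSet.empty, chi_eq_zero _ (by simp), map_zero]
  not_measurable' E hE := dif_neg hE
  m_iUnion' E hE hd := by
    rw [dif_pos (MeasurableSet.iUnion hE)]
    simp_rw [dif_pos (hE _)]
    exact hasSum_functional_chi hc hφ hE hd

theorem functionalMeasure_apply {β : Seminorm ℂ LInfty} (hc : IsContinuousGauge β)
    {φ : LInfty →ₗ[ℂ] ℂ} {C : ℝ} (hφ : ∀ u, ‖φ u‖ ≤ C * β u) {E : Set Circle}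
    (hE : MeasurableSet E) : functionalMeasure hc hφ E = φ (chi hE) :=
  dif_pos hE

/-- Null sets have zero characteristic function in `L^∞`, so `E ↦ φ(χ_E)` is absolutely continuous;
Radon–Nikodym applies to its real and imaginary parts. -/
theorem exists_density_functional {β : Seminorm ℂ LInfty} (hc : IsContinuousGauge β)
    {φ : LInfty →ₗ[ℂ] ℂ} {C : ℝ} (hφ : ∀ u, ‖φ u‖ ≤ C * β u) :
    ∃ g : Circle → ℂ, Integrable g m ∧
      ∀ (E : Set Circle) (hE : MeasurableSet E), φ (chi hE) = ∫ x in E, g x ∂m := by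
  set c := functionalMeasure hc hφ with hcdef
  have hac : c ≪ᵥ m.toENNRealVectorMeasure := by
    refine VectorMeasure.AbsolutelyContinuous.mk fun E hE h => ?_
    rw [Measure.toENNRealVectorMeasure_apply_measurable hE] at h
    rw [hcdef, functionalMeasure_apply hc hφ hE, chi_eq_zero hE h, map_zero]
  obtain ⟨hre, him⟩ := (c.absolutelyContinuous_ennreal_iff _).1 hac
  have hre' := (SignedMeasure.absolutelyContinuous_iff_withDensityᵥ_rnDeriv_eq _ m).1 hre
  have him' := (SignedMeasure.absolutelyContinuous_iff_withDensityᵥ_rnDeriv_eq _ m).1 him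
  have hint := c.integrable_rnDeriv m
  refine ⟨c.rnDeriv m, hint, fun E hE => ?_⟩
  rw [← functionalMeasure_apply hc hφ hE, ← hcdef]
  apply Complex.ext
  · have h1 : (c E).re = ComplexMeasure.re c E := rfl
    rw [h1, ← hre', withDensityᵥ_apply (SignedMeasure.integrable_rnDeriv _ _) hE]
    exact Complex.reCLM.integral_comp_comm hint.integrableOn
  · have h1 : (c E).im = ComplexMeasure.im c E := rfl
    rw [h1, ← him', withDensityᵥ_apply (SignedMeasure.integrable_rnDeriv _ _) hE]
    exact Complex.imCLM.integral_comp_comm hint.integrableOn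

/-- A complex simple function, as an element of `L^∞`. -/
def complexSimpleInf (s : SimpleFunc Circle ℂ) : LInfty :=
  MemLp.toLp s (SimpleFunc.memLp_top s m)

theorem complexSimpleInf_coe (s : SimpleFunc Circle ℂ) : complexSimpleInf s =ᵐ[m] s :=
  MemLp.coeFn_toLp _

/-- The formula extends from characteristic functions to simple functions by linearity. Along
uniformly bounded simple approximants both sides converge: `φ` by dominated convergence for `β`, the
integral by the classical theorem. -/
theorem functional_eq_integral {β : Seminorm ℂ LInfty} (hβ : IsSolid β) (hc : IsContinuousGauge β)
    {φ : LInfty →ₗ[ℂ] ℂ} {C : ℝ} (hφ : ∀ u, ‖φ u‖ ≤ C * β u) :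
    ∃ g : Circle → ℂ, Integrable g m ∧ ∀ u : LInfty, φ u = ∫ x, u x * g x ∂m := by
  obtain ⟨g, hg, hE⟩ := exists_density_functional hc hφ
  refine ⟨g, hg, ?_⟩
  have hs : ∀ s : SimpleFunc Circle ℂ, φ (complexSimpleInf s) = ∫ x, s x * g x ∂m := by
    intro s
    induction s using SimpleFunc.induction with
    | const c hS =>
      rename_i S
      have e : complexSimpleInf (SimpleFunc.piecewise S hS (SimpleFunc.const Circle c)
          (SimpleFunc.const Circle 0)) = c • chi hS := by
        apply Lp.ext
        filter_upwards [complexSimpleInf_coe (SimpleFunc.piecewise S hS (SimpleFunc.const Circle c)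
          (SimpleFunc.const Circle 0)), Lp.coeFn_smul c (chi hS), chi_coe hS] with x h1 h2 h3
        rw [h1, h2, Pi.smul_apply, h3]
        by_cases hx : x ∈ S <;> simp [hx]
      rw [e, map_smul, hE S hS, smul_eq_mul, ← integral_const_mul, ← integral_indicator hS]
      refine integral_congr_ae (Eventually.of_forall fun x => ?_)
      by_cases hx : x ∈ S <;> simp [hx]
    | add hd hf hg' =>
      rename_i s t
      have e : complexSimpleInf (s + t) = complexSimpleInf s + complexSimpleInf t := by
        apply Lp.ext
        filter_upwards [complexSimpleInf_coe (s + t), complexSimpleInf_coe s,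
          complexSimpleInf_coe t, Lp.coeFn_add (complexSimpleInf s) (complexSimpleInf t)]
          with x h1 h2 h3 h4
        rw [h1, h4, Pi.add_apply, h2, h3]; rfl
      have hi : ∀ s : SimpleFunc Circle ℂ, Integrable (fun x => s x * g x) m := fun s => by
        refine (integrable_mul_L1 (complexSimpleInf s) hg).congr ?_
        filter_upwards [complexSimpleInf_coe s] with x hx
        rw [hx]
      rw [e, map_add, hf, hg', ← integral_add (hi s) (hi t)]
      simp [add_mul]
  intro u
  have hu := Lp.stronglyMeasurable u
  let s : ℕ → SimpleFunc Circle ℂ := hu.approxBounded ‖u‖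
  have hsb : ∀ n x, ‖s n x‖ ≤ ‖u‖ := hu.norm_approxBounded_le (norm_nonneg u)
  have hst : ∀ᵐ x ∂m, Tendsto (fun n => s n x) atTop (𝓝 (u x)) :=
    hu.tendsto_approxBounded_ae (ae_norm_le u)
  have hcoe : ∀ᵐ x ∂m, ∀ n, (complexSimpleInf (s n) - u : LInfty) x = s n x - u x := by
    rw [ae_all_iff]
    intro n
    filter_upwards [Lp.coeFn_sub (complexSimpleInf (s n)) u, complexSimpleInf_coe (s n)]
      with x h1 h2
    rw [h1, Pi.sub_apply, h2]
  have hlim : Tendsto (fun n => β (complexSimpleInf (s n) - u)) atTop (𝓝 0) := by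
    refine hβ.tendsto_zero hc (C := ‖u‖ + ‖u‖) (fun n => ?_) ?_
    · filter_upwards [hcoe, ae_norm_le u] with x h1 h2
      rw [h1 n]
      exact (norm_sub_le _ _).trans (add_le_add (hsb n x) h2)
    · filter_upwards [hcoe, hst] with x h1 h2
      simp_rw [h1]
      simpa using h2.sub_const (u x)
  have h1 : Tendsto (fun n => φ (complexSimpleInf (s n))) atTop (𝓝 (φ u)) := by
    rw [tendsto_iff_norm_sub_tendsto_zero]
    refine squeeze_zero (fun n => norm_nonneg _) (fun n => ?_) (by simpa using hlim.const_mul C)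
    rw [← map_sub]
    exact hφ _
  have h2 : Tendsto (fun n => φ (complexSimpleInf (s n))) atTop (𝓝 (∫ x, u x * g x ∂m)) := by
    simp_rw [hs]
    refine tendsto_integral_of_dominated_convergence (fun x => ‖u‖ * ‖g x‖)
      (fun n => ((s n).stronglyMeasurable.aestronglyMeasurable).mul hg.1)
      (hg.norm.const_mul _) (fun n => Eventually.of_forall fun x => ?_) ?_
    · rw [norm_mul]
      gcongr
      exact hsb n x
    · filter_upwards [hst] with x hx using hx.mul_const _
  exact tendsto_nhds_unique h1 h2

theorem exists_annihilator_of_seminorm {β : Seminorm ℂ LInfty} (hβ : IsSolid β)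
    (hc : IsContinuousGauge β) (N : Submodule ℂ LInfty) {f : LInfty} {ε : ℝ} (hε : 0 < ε)
    (hf : ∀ u ∈ N, ε ≤ β (f - u)) :
    ∃ g : Circle → ℂ, Integrable g m ∧ (∀ u ∈ N, ∫ x, u x * g x ∂m = 0) ∧
      ∫ x, f x * g x ∂m ≠ 0 := by
  obtain ⟨φ, C, h1, h2, h3⟩ := exists_functional_of_seminorm β N hε hf
  obtain ⟨g, hg, h⟩ := functional_eq_integral hβ hc h1
  exact ⟨g, hg, fun u hu => by rw [← h, h2 u hu], by rwa [← h]⟩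

/-! ### Fourier coefficients on the circle and polynomials in `z`. -/

instance isMulLeftInvariant_m : m.IsMulLeftInvariant :=
  inferInstanceAs (Measure.haarMeasure _).IsMulLeftInvariant

/-- Rotation by a point `w` with `w ^ j = -1` preserves the integral and changes its sign. -/
theorem integral_zpow {j : ℤ} (hj : j ≠ 0) : ∫ a : Circle, (a : ℂ) ^ j ∂m = 0 := by
  obtain ⟨w, hw⟩ : ∃ w : Circle, (w : ℂ) ^ j = -1 := by
    refine ⟨Circle.exp (Real.pi / j), ?_⟩
    have hj' : (j : ℝ) ≠ 0 := by exact_mod_cast hj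
    rw [← Circle.coe_zpow, ← Circle.exp_intCast_mul, mul_div_cancel₀ _ hj']
    simp
  have h := integral_mul_left_eq_self (μ := m) (fun a : Circle => (a : ℂ) ^ j) w
  simp only [Circle.coe_mul, mul_zpow, hw, integral_const_mul] at h
  have h2 : (2 : ℂ) * ∫ a : Circle, (a : ℂ) ^ j ∂m = 0 := by linear_combination (-1 : ℂ) * h
  simpa using h2

/-- The coordinate function as a bounded continuous function. -/
def zBdd : Circle →ᵇ ℂ :=
  BoundedContinuousFunction.mkOfCompact ⟨fun a : Circle => (a : ℂ), by fun_prop⟩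

/-- On the circle conjugation inverts `z`, so words in `z` and its conjugate are integer powers of
`z`. -/
theorem adjoin_zBdd_le_span {g : Circle →ᵇ ℂ} (hg : g ∈ StarAlgebra.adjoin ℂ {zBdd}) :
    g ∈ Submodule.span ℂ {g : Circle →ᵇ ℂ | ∃ j : ℤ, ∀ a, g a = (a : ℂ) ^ j} := by
  rw [← StarSubalgebra.mem_toSubalgebra, StarAlgebra.adjoin_toSubalgebra,
    ← Subalgebra.mem_toSubmodule, Algebra.adjoin_eq_span] at hg
  refine Submodule.span_mono ?_ hg
  intro g hg
  induction hg using Submonoid.closure_induction with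
  | mem g hg =>
    rcases hg with rfl | hg
    · exact ⟨1, fun a => (zpow_one (a : ℂ)).symm⟩
    · rw [Set.star_singleton] at hg
      subst hg
      refine ⟨-1, fun a => ?_⟩
      have : (star zBdd) a = (starRingEnd ℂ) (a : ℂ) := rfl
      rw [this, zpow_neg_one, ← Circle.coe_inv_eq_conj, Circle.coe_inv]
  | one => exact ⟨0, fun a => by simp⟩
  | mul g h _ _ ihg ihh =>
    obtain ⟨i, hi⟩ := ihg
    obtain ⟨j, hj⟩ := ihh
    refine ⟨i + j, fun a => ?_⟩
    rw [BoundedContinuousFunction.mul_apply, hi, hj, zpow_add₀ (Circle.coe_ne_zero a)]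

theorem integrable_mul_bdd {φ : Circle → ℂ} (hφ : Integrable φ m) (g : Circle →ᵇ ℂ) :
    Integrable (fun a => φ a * g a) m :=
  hφ.mul_bdd g.continuous.aestronglyMeasurable
    (Eventually.of_forall fun a => g.norm_coe_le_norm a)

/-- A nonnegative integrable function whose nonzero Fourier coefficients vanish is constant. -/
theorem ae_eq_const_of_moments {φ : Circle → ℝ} (hφm : Measurable φ) (hφ : Integrable φ m)
    (h0 : ∀ a, 0 ≤ φ a) (h : ∀ n : ℕ, ∫ a, (φ a : ℂ) * (a : ℂ) ^ (n + 1) ∂m = 0) :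
    φ =ᵐ[m] fun _ => ∫ a, φ a ∂m := by
  set c := ∫ a, φ a ∂m with hc
  have hc0 : 0 ≤ c := integral_nonneg h0
  let ψ : Circle → ℝ≥0 := fun a => (φ a).toNNReal
  have hψm : Measurable ψ := hφm.real_toNNReal
  have hψ : ∀ a, (ψ a : ℝ) = φ a := fun a => Real.coe_toNNReal _ (h0 a)
  have hfin : ∫⁻ a, (ψ a : ℝ≥0∞) ∂m ≠ ∞ := by
    have := hφ.lintegral_lt_top
    exact this.ne
  have hzero : ∀ j : ℤ, j ≠ 0 → ∫ a, (φ a : ℂ) * (a : ℂ) ^ j ∂m = 0 := by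
    -- Since `φ` is real, the negative coefficients are conjugates of the positive ones.
    have hpos : ∀ n : ℕ, ∫ a, (φ a : ℂ) * (a : ℂ) ^ (-((n : ℤ) + 1)) ∂m = 0 := by
      intro n
      have := congrArg (starRingEnd ℂ) (h n)
      rw [← integral_conj, map_zero] at this
      rw [← this]
      refine integral_congr_ae (Eventually.of_forall fun a => ?_)
      simp only [map_mul, Complex.conj_ofReal, map_pow]
      rw [← Circle.coe_inv_eq_conj, Circle.coe_inv, zpow_neg, inv_pow]
      norm_cast
    intro j hj
    rcases lt_or_gt_of_ne hj with hj | hj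
    · obtain ⟨n, rfl⟩ : ∃ n : ℕ, j = -((n : ℤ) + 1) := ⟨(-j - 1).toNat, by omega⟩
      exact hpos n
    · obtain ⟨n, rfl⟩ : ∃ n : ℕ, j = (n : ℤ) + 1 := ⟨(j - 1).toNat, by omega⟩
      exact_mod_cast h n
  have hint : ∀ g : Circle →ᵇ ℂ, g ∈ StarAlgebra.adjoin ℂ {zBdd} →
      ∫ a, (φ a : ℂ) * g a ∂m = ∫ a, (c : ℂ) * g a ∂m := by
    have hφC : Integrable (fun a => (φ a : ℂ)) m := hφ.ofReal
    intro g hg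
    replace hg := adjoin_zBdd_le_span hg
    induction hg using Submodule.span_induction with
    | mem g hg =>
      obtain ⟨j, hj⟩ := hg
      simp only [hj]
      rcases eq_or_ne j 0 with rfl | hj0
      · simp [hc, integral_complex_ofReal]
      · rw [hzero j hj0, integral_const_mul, integral_zpow hj0, mul_zero]
    | zero => simp
    | add g₁ g₂ _ _ h1 h2 =>
      simp only [BoundedContinuousFunction.add_apply, mul_add]
      rw [integral_add (integrable_mul_bdd hφC g₁) (integrable_mul_bdd hφC g₂),
        integral_add (integrable_mul_bdd (integrable_const _) g₁)
          (integrable_mul_bdd (integrable_const _) g₂), h1, h2]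
    | smul r g _ h1 =>
      simp only [BoundedContinuousFunction.smul_apply, smul_eq_mul, mul_left_comm _ r]
      rw [integral_const_mul, integral_const_mul r, h1]
  have : IsFiniteMeasure (m.withDensity fun a => (ψ a : ℝ≥0∞)) := isFiniteMeasure_withDensity hfin
  have : IsFiniteMeasure (m.withDensity fun _ => (c.toNNReal : ℝ≥0∞)) :=
    isFiniteMeasure_withDensity (by simp)
  -- Two finite measures with the same integrals over a point-separating star algebra agree; their
  -- densities are then equal almost everywhere.
  have hmeas : (m.withDensity fun a => (ψ a : ℝ≥0∞)) =
      m.withDensity fun _ => (c.toNNReal : ℝ≥0∞) := by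
    refine ext_of_forall_mem_subalgebra_integral_eq_of_pseudoEMetric_complete_countable
      (𝕜 := ℂ) (A := StarAlgebra.adjoin ℂ {zBdd}) ?_ ?_
    · intro a b hab
      refine ⟨zBdd, ⟨BoundedContinuousFunction.toContinuousMap zBdd,
        ⟨zBdd, StarAlgebra.self_mem_adjoin_singleton ℂ zBdd, rfl⟩, rfl⟩, ?_⟩
      intro h
      exact hab (Circle.ext h)
    · intro g hg
      rw [integral_withDensity_eq_integral_smul hψm,
        integral_withDensity_eq_integral_smul measurable_const]
      have := hint g hg
      simp only [NNReal.smul_def, hψ, Real.coe_toNNReal _ hc0, Complex.real_smul]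
      exact this
  have := (withDensity_eq_iff (by fun_prop) (by fun_prop) hfin).1 hmeas
  filter_upwards [this] with a ha
  rw [← hψ a, ENNReal.coe_inj.1 ha, Real.coe_toNNReal _ hc0]

/-- The function on the circle defined by a polynomial. -/
def polyFun (p : ℂ[X]) (a : Circle) : ℂ := p.eval (a : ℂ)

theorem continuous_polyFun (p : ℂ[X]) : Continuous (polyFun p) :=
  p.continuous.comp continuous_subtype_val

theorem exists_bound_polyFun (p : ℂ[X]) : ∃ C : ℝ, ∀ a, ‖polyFun p a‖ ≤ C := by
  obtain ⟨C, hC⟩ := isCompact_univ.exists_bound_of_continuousOn (continuous_polyFun p).continuousOn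
  exact ⟨C, fun a => hC a (Set.mem_univ a)⟩

theorem integrable_mul_polyFun {g : Circle → ℂ} (hg : Integrable g m) (p : ℂ[X]) :
    Integrable (fun a => polyFun p a * g a) m := by
  obtain ⟨C, hC⟩ := exists_bound_polyFun p
  exact hg.bdd_mul (continuous_polyFun p).aestronglyMeasurable (Eventually.of_forall hC)

theorem integrable_polyFun (p : ℂ[X]) : Integrable (polyFun p) m := by
  simpa using integrable_mul_polyFun (integrable_const (1 : ℂ)) p

theorem integral_polyFun (p : ℂ[X]) : ∫ a, polyFun p a ∂m = p.coeff 0 := by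
  induction p using Polynomial.induction_on' with
  | add p q hp hq =>
    have : polyFun (p + q) = fun a => polyFun p a + polyFun q a := by
      ext a; simp [polyFun]
    rw [this, integral_add (integrable_polyFun p) (integrable_polyFun q), hp, hq,
      Polynomial.coeff_add]
  | monomial n c =>
    simp only [polyFun, Polynomial.eval_monomial, integral_const_mul, Polynomial.coeff_monomial]
    rcases eq_or_ne n 0 with rfl | hn
    · simp
    · have := integral_zpow (j := n) (by exact_mod_cast hn)
      simp only [zpow_natCast] at this
      rw [this, if_neg hn, mul_zero]

/-! ### Szegő's extremal problem in weighted `L^2`. -/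

section Extremal

variable {k : Circle → ℝ}

theorem memLp_sqrt_mul_polyFun (hk : Integrable k m) (hk1 : ∀ a, 1 ≤ k a) (p : ℂ[X]) :
    MemLp (fun a => ((Real.sqrt (k a) : ℝ) : ℂ) * polyFun p a) 2 m := by
  have hm : AEStronglyMeasurable (fun a => ((Real.sqrt (k a) : ℝ) : ℂ) * polyFun p a) m :=
    (Complex.continuous_ofReal.comp_aestronglyMeasurable
      (Real.continuous_sqrt.comp_aestronglyMeasurable hk.1)).mul
      (continuous_polyFun p).aestronglyMeasurable
  rw [memLp_two_iff_integrable_sq_norm hm]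
  obtain ⟨C, hC⟩ := exists_bound_polyFun p
  refine (hk.mul_const (C ^ 2)).mono' (hm.norm.pow 2) (Eventually.of_forall fun a => ?_)
  have h0 : 0 ≤ k a := zero_le_one.trans (hk1 a)
  rw [Real.norm_of_nonneg (by positivity), norm_mul, Complex.norm_real,
    Real.norm_of_nonneg (Real.sqrt_nonneg _), mul_pow, Real.sq_sqrt h0]
  gcongr
  exact hC a

/-- The embedding of the polynomials, with weight `k`, into `L²`. -/
def weightedPoly (hk : Integrable k m) (hk1 : ∀ a, 1 ≤ k a) : ℂ[X] →ₗ[ℂ] Lp ℂ 2 m where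
  toFun p := (memLp_sqrt_mul_polyFun hk hk1 p).toLp _
  map_add' p q := by
    rw [← MemLp.toLp_add]
    congr 1
    ext a
    simp [polyFun, mul_add]
  map_smul' c p := by
    rw [RingHom.id_apply, ← MemLp.toLp_const_smul]
    congr 1
    ext a
    simp [polyFun, mul_left_comm]

theorem weightedPoly_coe (hk : Integrable k m) (hk1 : ∀ a, 1 ≤ k a) (p : ℂ[X]) :
    weightedPoly hk hk1 p =ᵐ[m] fun a => ((Real.sqrt (k a) : ℝ) : ℂ) * polyFun p a :=
  MemLp.coeFn_toLp (memLp_sqrt_mul_polyFun hk hk1 p)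

theorem norm_sq_eq_integral (u : Lp ℂ 2 m) : ‖u‖ ^ 2 = ∫ a, ‖u a‖ ^ 2 ∂m := by
  have h1 := @inner_self_eq_norm_sq_to_K ℂ _ _ _ _ u
  rw [L2.inner_def] at h1
  have : ∀ a, inner ℂ (u a) (u a) = ((‖u a‖ ^ 2 : ℝ) : ℂ) := fun a => by
    rw [inner_self_eq_norm_sq_to_K]; push_cast; rfl
  simp_rw [this] at h1
  rw [integral_complex_ofReal] at h1
  have h2 : ((∫ a, ‖u a‖ ^ 2 ∂m : ℝ) : ℂ) = ((‖u‖ ^ 2 : ℝ) : ℂ) := by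
    rw [h1]; push_cast; rfl
  exact_mod_cast h2.symm

theorem integral_norm_mul_le (u v : Lp ℂ 2 m) : ∫ a, ‖u a‖ * ‖v a‖ ∂m ≤ ‖u‖ * ‖v‖ := by
  let U : Lp ℝ 2 m := (Lp.memLp u).norm.toLp _
  let V : Lp ℝ 2 m := (Lp.memLp v).norm.toLp _
  have hU : ‖U‖ = ‖u‖ := by rw [Lp.norm_toLp, eLpNorm_norm, Lp.norm_def]
  have hV : ‖V‖ = ‖v‖ := by rw [Lp.norm_toLp, eLpNorm_norm, Lp.norm_def]
  have h := real_inner_le_norm U V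
  rw [hU, hV, L2.inner_def] at h
  refine le_trans (le_of_eq (integral_congr_ae ?_)) h
  filter_upwards [(Lp.memLp u).norm.coeFn_toLp, (Lp.memLp v).norm.coeFn_toLp] with a h1 h2
  have h1' : U a = ‖u a‖ := h1
  have h2' : V a = ‖v a‖ := h2
  rw [h1', h2']
  simp [mul_comm]

/-- The minimal element: the component of `1` orthogonal to the polynomials vanishing at `0`. -/
theorem exists_extremal (hk : Integrable k m) (hk1 : ∀ a, 1 ≤ k a) :
    ∃ (x : Lp ℂ 2 m) (p : ℕ → ℂ[X]),
      Tendsto (fun j => weightedPoly hk hk1 (1 - Polynomial.X * p j)) atTop (𝓝 x) ∧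
      (∀ r, inner ℂ (weightedPoly hk hk1 (Polynomial.X * r)) x = 0) ∧
      ‖x‖ ^ 2 ≤ ∫ a, k a ∂m := by
  set T := weightedPoly hk hk1
  set R : Submodule ℂ (Lp ℂ 2 m) := LinearMap.range (T ∘ₗ LinearMap.mulLeft ℂ Polynomial.X)
  set K := R.topologicalClosure
  have hKc : IsComplete (K : Set (Lp ℂ 2 m)) := R.isClosed_topologicalClosure.isComplete
  have : CompleteSpace K := hKc.completeSpace_coe
  have hmem : K.starProjection (T 1) ∈ K := K.starProjection_apply_mem (T 1)
  obtain ⟨y, hy, hyl⟩ := mem_closure_iff_seq_limit.1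
    (show K.starProjection (T 1) ∈ closure (R : Set _) from hmem)
  choose p hp using hy
  have horth : T 1 - K.starProjection (T 1) ∈ Kᗮ := K.sub_starProjection_mem_orthogonal (T 1)
  refine ⟨T 1 - K.starProjection (T 1), p, ?_, fun r => ?_, ?_⟩
  · have : (fun j => T (1 - Polynomial.X * p j)) = fun j => T 1 - y j := by
      ext1 j
      rw [map_sub, ← hp j]
      rfl
    rw [this]
    exact hyl.const_sub _
  · refine (Submodule.mem_orthogonal _ _).1 horth _ (R.le_topologicalClosure ⟨r, rfl⟩)
  · have h1 : ‖T 1 - K.starProjection (T 1)‖ ≤ ‖T 1‖ := by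
      have h2 := K.norm_sq_eq_add_norm_sq_starProjection (T 1)
      rw [Submodule.starProjection_orthogonal_val] at h2
      have h3 : ‖T 1 - K.starProjection (T 1)‖ ^ 2 ≤ ‖T 1‖ ^ 2 := by
        nlinarith [sq_nonneg ‖K.starProjection (T 1)‖]
      exact le_of_sq_le_sq h3 (norm_nonneg _)
    calc _ ≤ ‖T 1‖ ^ 2 := by gcongr
      _ = ∫ a, k a ∂m := by
        rw [norm_sq_eq_integral]
        refine integral_congr_ae ?_
        filter_upwards [weightedPoly_coe hk hk1 1] with a ha
        have h0 : 0 ≤ k a := zero_le_one.trans (hk1 a)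
        rw [ha, polyFun, Polynomial.eval_one, mul_one, Complex.norm_real,
          Real.norm_of_nonneg (Real.sqrt_nonneg _), Real.sq_sqrt h0]

/-- Multiplying an approximant of `x` by `z ^ (n + 1)` lands in the space orthogonal to `x`. In the
limit `|x|²` is orthogonal to every `z ^ (n + 1)`, so `ae_eq_const_of_moments` makes it constant. -/
theorem extremal_norm_const (hk : Integrable k m) (hk1 : ∀ a, 1 ≤ k a) {x : Lp ℂ 2 m}
    {p : ℕ → ℂ[X]}
    (hx : Tendsto (fun j => weightedPoly hk hk1 (1 - Polynomial.X * p j)) atTop (𝓝 x))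
    (ho : ∀ r, inner ℂ (weightedPoly hk hk1 (Polynomial.X * r)) x = 0) :
    (fun a => ‖x a‖ ^ 2) =ᵐ[m] fun _ => ‖x‖ ^ 2 := by
  rw [norm_sq_eq_integral]
  refine ae_eq_const_of_moments ((Lp.stronglyMeasurable x).norm.measurable.pow_const 2)
    ((memLp_two_iff_integrable_sq_norm (Lp.aestronglyMeasurable x)).1 (Lp.memLp x))
    (fun a => by positivity) fun n => ?_
  have hzc : Continuous fun a : Circle => (starRingEnd ℂ) ((a : ℂ) ^ (n + 1)) :=
    Complex.continuous_conj.comp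
      ((continuous_subtype_val : Continuous fun a : Circle => (a : ℂ)).pow _)
  have hw : MemLp (fun a : Circle => (starRingEnd ℂ) ((a : ℂ) ^ (n + 1)) * x a) 2 m := by
    refine (Lp.memLp x).mono (hzc.aestronglyMeasurable.mul (Lp.aestronglyMeasurable x))
      (Eventually.of_forall fun a => ?_)
    rw [norm_mul, RCLike.norm_conj, norm_pow, Circle.norm_coe, one_pow, one_mul]
  -- Pairing with `w` transfers the factor `z ^ (n + 1)` from the approximants to `x`, so that their
  -- limit can be taken.
  let w : Lp ℂ 2 m := hw.toLp _
  have hzero : ∀ j, inner ℂ (weightedPoly hk hk1 (1 - Polynomial.X * p j)) w = 0 := by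
    intro j
    rw [← ho (Polynomial.X ^ n * (1 - Polynomial.X * p j)), L2.inner_def, L2.inner_def]
    refine integral_congr_ae ?_
    filter_upwards [hw.coeFn_toLp, weightedPoly_coe hk hk1 (1 - Polynomial.X * p j),
      weightedPoly_coe hk hk1 (Polynomial.X * (Polynomial.X ^ n * (1 - Polynomial.X * p j)))]
      with a h1 h2 h3
    have h1' : w a = _ := h1
    rw [h1', h2, h3, RCLike.inner_apply, RCLike.inner_apply]
    simp only [polyFun, Polynomial.eval_mul, Polynomial.eval_X, Polynomial.eval_pow, map_mul,
      map_pow]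
    ring
  have hlim : Tendsto (fun j => inner ℂ (weightedPoly hk hk1 (1 - Polynomial.X * p j)) w) atTop
      (𝓝 (inner ℂ x w)) := hx.inner tendsto_const_nhds
  simp_rw [hzero] at hlim
  have h0 : inner ℂ x w = 0 := tendsto_nhds_unique hlim tendsto_const_nhds
  have h1 := congrArg (starRingEnd ℂ) h0
  rw [L2.inner_def, ← integral_conj, map_zero] at h1
  rw [← h1]
  refine integral_congr_ae ?_
  filter_upwards [hw.coeFn_toLp] with a ha
  have ha' : w a = _ := ha
  rw [ha', RCLike.inner_apply, mul_assoc, RCLike.mul_conj, map_mul, starRingEnd_self_apply]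
  push_cast
  rw [map_pow, RCLike.conj_ofReal, mul_comm]
  rfl

end Extremal

/-! ### Multipliers that are limits of polynomials. -/

theorem tendsto_integral_norm_sq_sub {x : Lp ℂ 2 m} {y : ℕ → Lp ℂ 2 m}
    (hy : Tendsto y atTop (𝓝 x)) :
    Tendsto (fun j => ∫ a, ‖y j a ^ 2 - x a ^ 2‖ ∂m) atTop (𝓝 0) := by
  have h1 : ∀ j, ∫ a, ‖y j a ^ 2 - x a ^ 2‖ ∂m ≤ ‖y j - x‖ * ‖y j + x‖ := fun j => by
    refine le_trans (le_of_eq (integral_congr_ae ?_)) (integral_norm_mul_le _ _)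
    filter_upwards [Lp.coeFn_sub (y j) x, Lp.coeFn_add (y j) x] with a h1 h2
    rw [h1, h2, Pi.sub_apply, Pi.add_apply, ← norm_mul]
    congr 1
    ring
  refine squeeze_zero (fun j => integral_nonneg fun a => norm_nonneg _) h1 ?_
  have h2 : Tendsto (fun j => ‖y j - x‖) atTop (𝓝 0) := by
    simpa using (hy.sub_const x).norm
  have h3 : Tendsto (fun j => ‖y j + x‖) atTop (𝓝 ‖x + x‖) := (hy.add_const x).norm
  simpa using h2.mul h3

/-- With `x` extremal and `c = ‖x‖²`, take `q = x² / (c k)`; `|x|² = c` gives `|q| = 1/k`. The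
approximants satisfy `y j ² = k (1 - X p j)²`, so `P j = c⁻¹ (1 - X p j)²` has weighted error `c⁻¹
|y j ² - x²|`: squaring turns `L^2` convergence into `L^1` convergence. The mean of `q` is the limit
of `P j (0) = c⁻¹`. -/
theorem exists_multiplier {k : Circle → ℝ} (hk : Integrable k m) (hk1 : ∀ a, 1 ≤ k a) :
    ∃ (q : LInfty) (P : ℕ → ℂ[X]) (c : ℝ), 0 < c ∧ c ≤ ∫ a, k a ∂m ∧
      (∀ᵐ a ∂m, k a * ‖q a‖ = 1) ∧ ∫ a, q a ∂m = ((c⁻¹ : ℝ) : ℂ) ∧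
      (∀ j, Integrable (fun a => k a * ‖polyFun (P j) a - q a‖) m) ∧
      Tendsto (fun j => ∫ a, k a * ‖polyFun (P j) a - q a‖ ∂m) atTop (𝓝 0) := by
  obtain ⟨x, p, hx, ho, hxk⟩ := exists_extremal hk hk1
  have hconst := extremal_norm_const hk hk1 hx ho
  set y := fun j => weightedPoly hk hk1 (1 - Polynomial.X * p j) with hy
  set c := ‖x‖ ^ 2 with hc
  have hk0 : ∀ a, 0 < k a := fun a => zero_lt_one.trans_le (hk1 a)
  have hysq : ∀ j, ∀ᵐ a ∂m, y j a ^ 2 = (k a : ℂ) * polyFun ((1 - Polynomial.X * p j) ^ 2) a := by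
    intro j
    filter_upwards [weightedPoly_coe hk hk1 (1 - Polynomial.X * p j)] with a ha
    rw [hy]
    simp only [ha, polyFun, Polynomial.eval_pow, mul_pow]
    rw [← Complex.ofReal_pow, Real.sq_sqrt (hk0 a).le]
  have hcoeff : ∀ j, ((1 - Polynomial.X * p j) ^ 2).coeff 0 = 1 := fun j => by
    simp [pow_two, Polynomial.mul_coeff_zero]
  -- The polynomial `(1 - X p j)²` has mean `1`, and `k ≥ 1`, so no approximant has norm below `1`;
  -- this excludes `x = 0`.
  have hc1 : 1 ≤ c := by
    have h1 : ∀ j, 1 ≤ ‖y j‖ ^ 2 := by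
      intro j
      have e := integral_polyFun ((1 - Polynomial.X * p j) ^ 2)
      rw [hcoeff] at e
      have h2 := norm_integral_le_integral_norm (μ := m) (polyFun ((1 - Polynomial.X * p j) ^ 2))
      rw [e, norm_one] at h2
      refine h2.trans ?_
      rw [norm_sq_eq_integral]
      refine integral_mono_ae (integrable_polyFun _).norm
        ((memLp_two_iff_integrable_sq_norm (Lp.aestronglyMeasurable _)).1 (Lp.memLp _)) ?_
      filter_upwards [hysq j] with a ha
      rw [← norm_pow, ha, norm_mul, Complex.norm_real, Real.norm_of_nonneg (hk0 a).le]
      exact le_mul_of_one_le_left (norm_nonneg _) (hk1 a)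
    exact ge_of_tendsto' (hx.norm.pow 2) h1
  have hc0 : 0 < c := zero_lt_one.trans_le hc1
  have hcC : (c : ℂ) ≠ 0 := by exact_mod_cast hc0.ne'
  have hqm : AEStronglyMeasurable (fun a => x a ^ 2 / ((c : ℂ) * (k a : ℂ))) m := by
    refine AEMeasurable.aestronglyMeasurable ?_
    refine ((Lp.stronglyMeasurable x).measurable.pow_const 2).aemeasurable.div
      (AEMeasurable.const_mul ?_ _)
    exact (Complex.continuous_ofReal.comp_aestronglyMeasurable hk.1).aemeasurable
  have hqn : ∀ᵐ a ∂m, ‖x a ^ 2 / ((c : ℂ) * (k a : ℂ))‖ = (k a)⁻¹ := by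
    filter_upwards [hconst] with a ha
    rw [norm_div, norm_pow, ha, norm_mul, Complex.norm_real, Complex.norm_real,
      Real.norm_of_nonneg (hk0 a).le, Real.norm_of_nonneg hc0.le]
    have := (hk0 a).ne'
    field_simp
  have hqb : ∀ᵐ a ∂m, ‖x a ^ 2 / ((c : ℂ) * (k a : ℂ))‖ ≤ 1 := by
    filter_upwards [hqn] with a ha
    rw [ha]
    exact inv_le_one_of_one_le₀ (hk1 a)
  let q := mkInf _ hqm 1 hqb
  have hq : q =ᵐ[m] _ := mkInf_coe _ hqm 1 hqb
  let P : ℕ → ℂ[X] := fun j => Polynomial.C (c : ℂ)⁻¹ * (1 - Polynomial.X * p j) ^ 2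
  have hPq : ∀ j, ∀ᵐ a ∂m, k a * ‖polyFun (P j) a - q a‖ = c⁻¹ * ‖y j a ^ 2 - x a ^ 2‖ := by
    intro j
    filter_upwards [hq, hysq j] with a h1 h2
    have e : polyFun (P j) a - q a = ((c⁻¹ * (k a)⁻¹ : ℝ) : ℂ) * (y j a ^ 2 - x a ^ 2) := by
      have hkC : (k a : ℂ) ≠ 0 := by exact_mod_cast (hk0 a).ne'
      rw [h1, h2]
      simp only [P, polyFun, Polynomial.eval_mul, Polynomial.eval_C]
      push_cast
      field_simp
    have hp : 0 < c⁻¹ * (k a)⁻¹ := mul_pos (inv_pos.2 hc0) (inv_pos.2 (hk0 a))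
    rw [e, norm_mul, Complex.norm_real, Real.norm_of_nonneg hp.le]
    have := (hk0 a).ne'
    field_simp
  have hint : ∀ j, Integrable (fun a => k a * ‖polyFun (P j) a - q a‖) m := by
    intro j
    have h1 : Integrable (fun a => (‖polyFun (P j) a‖ + ‖q a‖) * k a) m := by
      obtain ⟨C, hC⟩ := exists_bound_polyFun (P j)
      refine hk.bdd_mul (c := C + ‖q‖) ((continuous_polyFun _).aestronglyMeasurable.norm.add
        (Lp.aestronglyMeasurable q).norm) ?_
      filter_upwards [ae_norm_le q] with a ha
      rw [Real.norm_of_nonneg (by positivity)]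
      exact add_le_add (hC a) ha
    refine h1.mono' (hk.1.mul ((continuous_polyFun _).aestronglyMeasurable.sub
      (Lp.aestronglyMeasurable q)).norm) (Eventually.of_forall fun a => ?_)
    rw [norm_mul, norm_norm, Real.norm_of_nonneg (hk0 a).le, mul_comm]
    gcongr
    · exact (hk0 a).le
    · exact norm_sub_le _ _
  have hlim : Tendsto (fun j => ∫ a, k a * ‖polyFun (P j) a - q a‖ ∂m) atTop (𝓝 0) := by
    have h1 : ∀ j, ∫ a, k a * ‖polyFun (P j) a - q a‖ ∂m
        = c⁻¹ * ∫ a, ‖y j a ^ 2 - x a ^ 2‖ ∂m := fun j => by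
      rw [← integral_const_mul]
      exact integral_congr_ae (hPq j)
    simp_rw [h1]
    simpa using (tendsto_integral_norm_sq_sub hx).const_mul c⁻¹
  refine ⟨q, P, c, hc0, hxk, ?_, ?_, hint, hlim⟩
  · filter_upwards [hq, hqn] with a h1 h2
    rw [h1, h2, mul_inv_cancel₀ (hk0 a).ne']
  · have hqi : Integrable q m := (Lp.memLp q).integrable le_top
    have h1 : ∀ j, ‖((c⁻¹ : ℝ) : ℂ) - ∫ a, q a ∂m‖ ≤ ∫ a, k a * ‖polyFun (P j) a - q a‖ ∂m := by
      intro j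
      have e : ((c⁻¹ : ℝ) : ℂ) = ∫ a, polyFun (P j) a ∂m := by
        rw [integral_polyFun, Polynomial.coeff_C_mul, hcoeff]
        push_cast
        rw [mul_one]
      rw [e, ← integral_sub (integrable_polyFun _) hqi]
      refine (norm_integral_le_integral_norm _).trans
        (integral_mono ((integrable_polyFun _).sub hqi).norm (hint j) fun a => ?_)
      exact le_mul_of_one_le_left (norm_nonneg _) (hk1 a)
    have h2 := ge_of_tendsto' hlim h1
    exact (sub_eq_zero.1 (norm_le_zero_iff.1 h2)).symm

/-- For an integrable `F ≥ 0` there are bounded functions `q n → 1`, each of them a limit of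
polynomials in `z` for the weight `1 + F`, such that `q n * F` is bounded. -/
theorem exists_multiplier_seq {F : Circle → ℝ} (hF : Integrable F m) (hF0 : ∀ a, 0 ≤ F a) :
    ∃ q : ℕ → LInfty, (∀ n, ∀ᵐ a ∂m, ‖q n a‖ ≤ 1) ∧
      (∀ n, ∃ C : ℝ, ∀ᵐ a ∂m, ‖q n a‖ * F a ≤ C) ∧
      (∀ᵐ a ∂m, Tendsto (fun n => q n a) atTop (𝓝 1)) ∧
      ∀ n, ∃ P : ℕ → ℂ[X],
        (∀ j, Integrable (fun a => (1 + F a) * ‖polyFun (P j) a - q n a‖) m) ∧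
        Tendsto (fun j => ∫ a, (1 + F a) * ‖polyFun (P j) a - q n a‖ ∂m) atTop (𝓝 0) := by
  -- The means of these weights tend to `1`, which forces `c n → 1`, yet each is comparable to `1 +
  -- F`.
  let k : ℕ → Circle → ℝ := fun n a => 1 + F a / (n + 1)
  have hk : ∀ n, Integrable (k n) m := fun n => (integrable_const 1).add (hF.div_const _)
  have hk1 : ∀ n a, 1 ≤ k n a := fun n a => by
    have := hF0 a
    simp only [k]
    have : 0 ≤ F a / (n + 1) := by positivity
    linarith
  have hkF : ∀ n a, 1 + F a ≤ (n + 1) * k n a := fun n a => by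
    have h : ((n : ℝ) + 1) * k n a = (n + 1) + F a := by
      simp only [k]
      field_simp
    rw [h]
    have : (0 : ℝ) ≤ n := n.cast_nonneg
    linarith
  choose q P c hc0 hck hqk hqi hint hlim using fun n => exists_multiplier (hk n) (hk1 n)
  have hq1 : ∀ n, ∀ᵐ a ∂m, ‖q n a‖ ≤ 1 := fun n => by
    filter_upwards [hqk n] with a ha
    rw [← ha]
    exact le_mul_of_one_le_left (norm_nonneg _) (hk1 n a)
  have hint' : ∀ n j, Integrable (fun a => (1 + F a) * ‖polyFun (P n j) a - q n a‖) m :=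
    fun n j => by
      refine ((hint n j).const_mul ((n : ℝ) + 1)).mono' (((integrable_const 1).add hF).1.mul
        ((continuous_polyFun _).aestronglyMeasurable.sub (Lp.aestronglyMeasurable _)).norm)
        (Eventually.of_forall fun a => ?_)
      have := hF0 a
      rw [Real.norm_of_nonneg (by positivity), ← mul_assoc]
      gcongr
      exact hkF n a
  have hlim' : ∀ n, Tendsto (fun j => ∫ a, (1 + F a) * ‖polyFun (P n j) a - q n a‖ ∂m) atTop
      (𝓝 0) := fun n => by
    refine squeeze_zero (fun j => integral_nonneg fun a => ?_) (fun j => ?_)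
      (by simpa using (hlim n).const_mul ((n : ℝ) + 1))
    · have := hF0 a
      positivity
    · rw [← integral_const_mul]
      refine integral_mono (hint' n j) ((hint n j).const_mul _) fun a => ?_
      simp only [← mul_assoc]
      gcongr
      exact hkF n a
  -- Expand `|q - 1|² = |q|² + 1 - 2 Re q`, with `|q| ≤ 1` and `∫ Re q = c⁻¹`.
  have hL2 : ∀ n, ∫ a, ‖q n a - 1‖ ^ 2 ∂m ≤ 2 - 2 * (c n)⁻¹ := by
    intro n
    have hqint : Integrable (q n) m := (Lp.memLp (q n)).integrable le_top
    have hre : ∫ a, (q n a).re ∂m = (c n)⁻¹ := by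
      have h := Complex.reCLM.integral_comp_comm hqint
      rw [hqi n] at h
      exact h
    have hrei : Integrable (fun a => (q n a).re) m := hqint.re
    have e : 2 - 2 * (c n)⁻¹ = ∫ a, (2 - 2 * (q n a).re) ∂m := by
      rw [integral_sub (integrable_const _) (hrei.const_mul 2), integral_const_mul, hre]
      simp
    rw [e]
    refine integral_mono_of_nonneg (Eventually.of_forall fun a => by positivity)
      ((integrable_const _).sub (hrei.const_mul 2)) ?_
    filter_upwards [hq1 n] with a ha
    have h1 : ‖q n a - 1‖ ^ 2 = ‖q n a‖ ^ 2 + 1 - 2 * (q n a).re := by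
      rw [← Complex.normSq_eq_norm_sq, ← Complex.normSq_eq_norm_sq, Complex.normSq_sub]
      simp
    rw [h1]
    have : ‖q n a‖ ^ 2 ≤ 1 := pow_le_one₀ (norm_nonneg _) ha
    linarith
  have hcl : Tendsto (fun n : ℕ => 2 - 2 * (1 + (∫ a, F a ∂m) / ((n : ℝ) + 1))⁻¹) atTop (𝓝 0) := by
    have h1 : Tendsto (fun n : ℕ => (∫ a, F a ∂m) / ((n : ℝ) + 1)) atTop (𝓝 0) :=
      tendsto_const_nhds.div_atTop (tendsto_atTop_add_const_right _ _ tendsto_natCast_atTop_atTop)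
    have h2 := (((h1.const_add 1).inv₀ (by norm_num)).const_mul 2).const_sub 2
    simpa using h2
  have hsq : Tendsto (fun n => ∫ a, ‖q n a - 1‖ ^ 2 ∂m) atTop (𝓝 0) := by
    refine squeeze_zero (fun n => integral_nonneg fun a => by positivity) (fun n => ?_) hcl
    refine (hL2 n).trans ?_
    have hi : ∫ a, k n a ∂m = 1 + (∫ a, F a ∂m) / ((n : ℝ) + 1) := by
      simp only [k]
      rw [integral_add (integrable_const _) (hF.div_const _), integral_div]
      simp
    have h3 := hck n
    rw [hi] at h3
    have h4 := inv_anti₀ (hc0 n) h3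
    linarith
  have hmeas : ∀ n, AEStronglyMeasurable (fun a => ‖q n a - 1‖ ^ 2) m := fun n =>
    ((Lp.aestronglyMeasurable (q n)).sub aestronglyMeasurable_const).norm.pow 2
  have hmeasure : TendstoInMeasure m (fun n a => ‖q n a - 1‖ ^ 2) atTop fun _ => (0 : ℝ) := by
    refine tendstoInMeasure_of_tendsto_eLpNorm one_ne_zero hmeas aestronglyMeasurable_const ?_
    have e : ∀ n, eLpNorm ((fun a => ‖q n a - 1‖ ^ 2) - fun _ => (0 : ℝ)) 1 m
        = ENNReal.ofReal (∫ a, ‖q n a - 1‖ ^ 2 ∂m) := fun n => by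
      have hi : Integrable (fun a => ‖q n a - 1‖ ^ 2) m := by
        refine (integrable_const (4 : ℝ)).mono' (hmeas n) ?_
        filter_upwards [hq1 n] with a ha
        rw [Real.norm_of_nonneg (by positivity)]
        have := norm_sub_le (q n a) 1
        rw [norm_one] at this
        nlinarith [norm_nonneg (q n a - 1)]
      have : ((fun a => ‖q n a - 1‖ ^ 2) - fun _ => (0 : ℝ)) = fun a => ‖q n a - 1‖ ^ 2 := by
        ext; simp
      rw [this, eLpNorm_one_eq_lintegral_enorm, ← ofReal_integral_norm_eq_lintegral_enorm hi]
      simp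
    simp_rw [e]
    simpa using (ENNReal.tendsto_ofReal hsq)
  -- Mean-square convergence gives almost everywhere convergence only along a subsequence.
  obtain ⟨ns, -, hae⟩ := hmeasure.exists_seq_tendsto_ae
  refine ⟨fun n => q (ns n), fun n => hq1 _, fun n => ⟨ns n + 1, ?_⟩, ?_,
    fun n => ⟨P (ns n), hint' _, hlim' _⟩⟩
  · filter_upwards [hqk (ns n)] with a ha
    calc ‖q (ns n) a‖ * F a ≤ ‖q (ns n) a‖ * ((ns n + 1) * k (ns n) a) := by
          gcongr
          linarith [hkF (ns n) a]
      _ = ns n + 1 := by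
          rw [mul_left_comm, mul_comm ‖_‖, ha, mul_one]
  · filter_upwards [hae] with a ha
    rw [tendsto_iff_norm_sub_tendsto_zero]
    have := ha.sqrt
    simpa [Real.sqrt_sq (norm_nonneg _)] using this

/-! ### Annihilators under multipliers, and invariance under polynomials. -/

theorem integral_eq_zero_of_approx {A : Circle → ℂ} {A' : ℕ → Circle → ℂ} {B : ℕ → Circle → ℝ}
    {C : ℝ} (hA : Integrable A m) (hA' : ∀ j, Integrable (A' j) m) (hB : ∀ j, Integrable (B j) m)
    (hAB : ∀ j, ∀ᵐ a ∂m, ‖A' j a - A a‖ ≤ C * B j a)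
    (hlim : Tendsto (fun j => ∫ a, B j a ∂m) atTop (𝓝 0)) (h0 : ∀ j, ∫ a, A' j a ∂m = 0) :
    ∫ a, A a ∂m = 0 := by
  have h1 : ∀ j, ‖∫ a, A a ∂m‖ ≤ C * ∫ a, B j a ∂m := fun j => by
    have e : -∫ a, A a ∂m = ∫ a, (A' j a - A a) ∂m := by
      rw [integral_sub (hA' j) hA, h0 j, zero_sub]
    rw [← norm_neg, e, ← integral_const_mul]
    exact (norm_integral_le_integral_norm _).trans
      (integral_mono_ae ((hA' j).sub hA).norm ((hB j).const_mul C) (hAB j))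
  have h2 := ge_of_tendsto' (hlim.const_mul C) h1
  rw [mul_zero] at h2
  exact norm_le_zero_iff.1 h2

theorem integrable_mul_mul {u v : LInfty} {g : Circle → ℂ} (hg : Integrable g m) :
    Integrable (fun a => u a * (v a * g a)) m :=
  integrable_mul_L1 u (integrable_mul_L1 v hg)

/-- If `q n → 1` boundedly and `g * q n` annihilates `u` for all `n`, then so does `g`. -/
theorem integral_eq_zero_of_multipliers {q : ℕ → LInfty} (hq1 : ∀ n, ∀ᵐ a ∂m, ‖q n a‖ ≤ 1)
    (hq : ∀ᵐ a ∂m, Tendsto (fun n => q n a) atTop (𝓝 1)) {g : Circle → ℂ} (hg : Integrable g m)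
    (u : LInfty) (h0 : ∀ n, ∫ a, u a * (q n a * g a) ∂m = 0) : ∫ a, u a * g a ∂m = 0 := by
  have hlim : Tendsto (fun n => ∫ a, u a * (q n a * g a) ∂m) atTop (𝓝 (∫ a, u a * g a ∂m)) := by
    refine tendsto_integral_of_dominated_convergence (fun a => ‖u a * g a‖)
      (fun n => (integrable_mul_mul hg).1) (integrable_mul_L1 u hg).norm (fun n => ?_) ?_
    · filter_upwards [hq1 n] with a ha
      rw [mul_left_comm, norm_mul]
      exact mul_le_of_le_one_left (norm_nonneg _) ha
    · filter_upwards [hq] with a ha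
      simpa using (ha.mul_const (g a)).const_mul (u a)
  simp_rw [h0] at hlim
  exact (tendsto_nhds_unique hlim tendsto_const_nhds)

/-- Convergence in `L^1` alone does not pass to the limit against an unbounded `G`. Multipliers for
`|G|` repair this: `q n * G` is bounded and still annihilates polynomials, hence annihilates `h`,
and then `n → ∞`. -/
theorem integral_mul_eq_zero_of_poly_limit {G : Circle → ℂ} (hG : Integrable G m)
    (hGp : ∀ p, ∫ a, polyFun p a * G a ∂m = 0) {h : LInfty} {Q : ℕ → ℂ[X]}
    (hQ : Tendsto (fun i => ∫ a, ‖polyFun (Q i) a - h a‖ ∂m) atTop (𝓝 0)) :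
    ∫ a, h a * G a ∂m = 0 := by
  obtain ⟨q, hq1, hqb, hql, hqP⟩ := exists_multiplier_seq hG.norm fun a => norm_nonneg _
  refine integral_eq_zero_of_multipliers hq1 hql hG h fun n => ?_
  obtain ⟨P, hPi, hPl⟩ := hqP n
  obtain ⟨C, hC⟩ := hqb n
  have hint := integrable_mul_L1 (q n) hG
  have hpoly : ∀ p, ∫ a, polyFun p a * (q n a * G a) ∂m = 0 := by
    intro p
    obtain ⟨D, hD⟩ := exists_bound_polyFun p
    refine integral_eq_zero_of_approx (A' := fun j a => polyFun (p * P j) a * G a) (C := D)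
      (integrable_mul_polyFun hint p) (fun j => integrable_mul_polyFun hG _) hPi
      (fun j => Eventually.of_forall fun a => ?_) hPl fun j => hGp _
    have e : polyFun (p * P j) a * G a - polyFun p a * (q n a * G a)
        = polyFun p a * (G a * (polyFun (P j) a - q n a)) := by
      simp only [polyFun, Polynomial.eval_mul]
      ring
    rw [e, norm_mul, norm_mul]
    have hD0 : 0 ≤ D := (norm_nonneg _).trans (hD a)
    gcongr
    · exact hD a
    · linarith
  have hh : Integrable h m := (Lp.memLp h).integrable le_top
  refine integral_eq_zero_of_approx (A' := fun i a => polyFun (Q i) a * (q n a * G a)) (C := C)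
    (integrable_mul_L1 h hint) (fun i => integrable_mul_polyFun hint _)
    (fun i => ((integrable_polyFun (Q i)).sub hh).norm) (fun i => ?_) hQ fun i => hpoly _
  filter_upwards [hC] with a ha
  rw [← sub_mul, norm_mul, norm_mul (q n a), mul_comm]
  exact mul_le_mul_of_nonneg_right ha (norm_nonneg _)

/-- A polynomial in `z`, as a measurable function. -/
def polyL0 (p : ℂ[X]) : L0 :=
  AEEqFun.mk (polyFun p) (continuous_polyFun p).aestronglyMeasurable

theorem polyL0_coe (p : ℂ[X]) : polyL0 p =ᵐ[m] polyFun p :=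
  AEEqFun.coeFn_mk _ _

theorem z_coe : z =ᵐ[m] fun a : Circle => (a : ℂ) :=
  ContinuousMap.coeFn_toAEEqFun _ _

theorem polyL0_mul_mem {S : Submodule ℂ L0} (hS : ∀ f ∈ S, z * f ∈ S) {f : L0} (hf : f ∈ S)
    (p : ℂ[X]) : polyL0 p * f ∈ S := by
  induction p using Polynomial.induction_on with
  | C c =>
    have e : polyL0 (Polynomial.C c) * f = c • f := by
      apply AEEqFun.ext
      filter_upwards [AEEqFun.coeFn_mul (polyL0 (Polynomial.C c)) f,
        polyL0_coe (Polynomial.C c), AEEqFun.coeFn_smul c f] with a h1 h2 h3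
      rw [h1, h3, Pi.mul_apply, h2]
      simp [polyFun]
    rw [e]
    exact S.smul_mem c hf
  | add p q hp hq =>
    have e : polyL0 (p + q) = polyL0 p + polyL0 q := by
      apply AEEqFun.ext
      filter_upwards [AEEqFun.coeFn_add (polyL0 p) (polyL0 q), polyL0_coe p, polyL0_coe q,
        polyL0_coe (p + q)] with a h1 h2 h3 h4
      rw [h1, h4, Pi.add_apply, h2, h3]
      simp [polyFun]
    rw [e, L0.add_mul']
    exact S.add_mem hp hq
  | monomial n c h =>
    have e : polyL0 (Polynomial.C c * Polynomial.X ^ (n + 1))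
        = z * polyL0 (Polynomial.C c * Polynomial.X ^ n) := by
      apply AEEqFun.ext
      filter_upwards [AEEqFun.coeFn_mul z (polyL0 (Polynomial.C c * Polynomial.X ^ n)), z_coe,
        polyL0_coe (Polynomial.C c * Polynomial.X ^ n),
        polyL0_coe (Polynomial.C c * Polynomial.X ^ (n + 1))] with a h1 h2 h3 h4
      rw [h1, h4, Pi.mul_apply, h2, h3]
      simp [polyFun, pow_succ]
      ring
    rw [e, mul_assoc]
    exact hS _ h

theorem exists_pos_le_gaugeExt {α : Seminorm ℂ LInfty} {W : Set L0} (hW : IsAlphaClosed α W)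
    {f : L0} (hf : f ∈ LAlpha α) (hfW : f ∉ W) :
    ∃ ε : ℝ, 0 < ε ∧ ∀ g ∈ W, ENNReal.ofReal ε ≤ gaugeExt α (f - g) := by
  by_contra! h
  refine hfW (hW.2 ⟨hf, fun ε hε => ?_⟩)
  -- The tolerance may be `∞`, whose `toReal` is `0`; hence the minimum with `1`.
  have hpos : 0 < (min ε 1).toReal :=
    ENNReal.toReal_pos (by simp [hε.ne']) (by simp)
  obtain ⟨g, hg, hlt⟩ := h _ hpos
  rw [ENNReal.ofReal_toReal (by simp)] at hlt
  exact ⟨g, hg, hlt.trans_le (min_le_left _ _)⟩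

/-- The inclusion of `L^∞` in the space of measurable functions. -/
def inclL0 : LInfty →ₗ[ℂ] L0 where
  toFun u := u
  map_add' _ _ := rfl
  map_smul' _ _ := rfl

/-- Multiplication by a measurable function, as a map defined on `L^∞`. -/
def mulL0 (f : L0) : LInfty →ₗ[ℂ] L0 where
  toFun u := (u : L0) * f
  map_add' u v := L0.add_mul' u v f
  map_smul' c u := L0.smul_mul' c u f

theorem isClosed_weakStar_of_annihilators (N : Submodule ℂ LInfty)
    (h : ∀ f ∉ N, ∃ g : Circle → ℂ, Integrable g m ∧ (∀ u ∈ N, ∫ x, u x * g x ∂m = 0) ∧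
      ∫ x, f x * g x ∂m ≠ 0) : @IsClosed LInfty weakStar N := by
  have e : (N : Set LInfty) = ⋂ g ∈ {g : Circle → ℂ | Integrable g m ∧
      ∀ u ∈ N, ∫ x, u x * g x ∂m = 0}, {u : LInfty | ∫ x, u x * g x ∂m = 0} := by
    ext f
    simp only [Set.mem_iInter]
    refine ⟨fun hf g hg => hg.2 f hf, fun hf => ?_⟩
    by_contra hfN
    obtain ⟨g, hg, h1, h2⟩ := h f hfN
    exact h2 (hf g ⟨hg, h1⟩)
  rw [e]
  exact @isClosed_biInter _ _ weakStar _ _ fun g hg => isClosed_annihilator g hg.1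

/-! ### The three statements. -/

section Main

variable {α : Seminorm ℂ LInfty}

/-- A bounded `f` outside `W` has positive `α`-distance from `W`, so an `L^1` function separates it
from `W ∩ L^∞`. -/
theorem isClosed_comap_inclL0 (hα : IsDominatingGauge α) (hc : IsContinuousGauge α)
    (W : Submodule ℂ L0) (hW : IsAlphaClosed α (W : Set L0)) :
    @IsClosed LInfty weakStar (W.comap inclL0 : Submodule ℂ LInfty) := by
  refine isClosed_weakStar_of_annihilators _ fun f hf => ?_
  obtain ⟨ε, hε, h⟩ := exists_pos_le_gaugeExt hW (linfSet_subset_LAlpha hα hc f.2) hf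
  refine exists_annihilator_of_seminorm (isSolid_gauge hα) hc _ hε fun u hu => ?_
  have h1 : ENNReal.ofReal ε ≤ gaugeExt α ((f - u : LInfty) : L0) := h u hu
  rw [gaugeExt_coe hα hc] at h1
  exact (ENNReal.ofReal_le_ofReal_iff (apply_nonneg _ _)).1 h1

theorem tendsto_integral_norm_of_gaugeExt (hα : IsDominatingGauge α) {f : ℕ → L0}
    (hf : ∀ j, Integrable (f j) m) (h : Tendsto (fun j => gaugeExt α (f j)) atTop (𝓝 0)) :
    Tendsto (fun j => ∫ a, ‖f j a‖ ∂m) atTop (𝓝 0) := by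
  have h1 : Tendsto (fun j => ENNReal.ofReal (∫ a, ‖f j a‖ ∂m)) atTop (𝓝 0) := by
    refine tendsto_of_tendsto_of_tendsto_of_le_of_le tendsto_const_nhds h (fun _ => zero_le)
      fun j => ?_
    rw [ofReal_integral_norm_eq_lintegral_enorm (hf j)]
    exact lintegral_le_gaugeExt hα (f j)
  have h2 := (ENNReal.tendsto_toReal ENNReal.zero_ne_top).comp h1
  refine h2.congr fun j => ?_
  exact ENNReal.toReal_ofReal (integral_nonneg fun a => norm_nonneg _)

theorem mem_of_mem_alphaClosure (hα : IsDominatingGauge α) (M : Submodule ℂ L0)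
    (hM : IsWeakStarClosed (M : Set L0)) (hzM : ∀ f ∈ M, z * f ∈ M) (f : LInfty)
    (hf : (f : L0) ∈ alphaClosure α (M : Set L0)) : (f : L0) ∈ M := by
  by_contra hfM
  obtain ⟨g, hg, hgM, hgf⟩ := exists_annihilator_of_weakStarClosed (M.comap inclL0) hM.2
    (f := f) hfM
  refine hgf ?_
  obtain ⟨q, hq1, hqb, hql, hqP⟩ := exists_multiplier_seq hg.norm fun a => norm_nonneg _
  refine integral_eq_zero_of_multipliers hq1 hql hg f fun n => ?_
  obtain ⟨P, hPi, hPl⟩ := hqP n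
  obtain ⟨C, hC⟩ := hqb n
  have hint := integrable_mul_L1 (q n) hg
  -- Polynomial multiples of `u` stay in `M`, so `g` kills them; the weight `1 + |g|` lets the
  -- polynomials be replaced by their limit `q n`.
  have hMq : ∀ u : LInfty, (u : L0) ∈ M → ∫ a, u a * (q n a * g a) ∂m = 0 := by
    intro u hu
    have hmem : ∀ j, polyL0 (P j) * (u : L0) ∈ M := fun j => polyL0_mul_mem hzM hu _
    let v : ℕ → LInfty := fun j => ⟨_, hM.1 (hmem j)⟩
    have hv : ∀ j, ∀ᵐ a ∂m, v j a = polyFun (P j) a * u a := fun j => by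
      filter_upwards [AEEqFun.coeFn_mul (polyL0 (P j)) (u : L0), polyL0_coe (P j)] with a h1 h2
      have h1' : v j a = _ := h1
      rw [h1', Pi.mul_apply, h2]
    refine integral_eq_zero_of_approx (A' := fun j a => v j a * g a) (C := ‖u‖)
      (integrable_mul_L1 u hint) (fun j => integrable_mul_L1 _ hg) hPi (fun j => ?_) hPl
      fun j => hgM _ (hmem j)
    filter_upwards [hv j, ae_norm_le u] with a h1 h2
    have e : v j a * g a - u a * (q n a * g a) = u a * (g a * (polyFun (P j) a - q n a)) := by
      rw [h1]
      ring
    rw [e, norm_mul, norm_mul]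
    gcongr
    linarith
  choose v hvM hv using fun j : ℕ => hf.2 ((j : ℝ≥0∞) + 1)⁻¹ (by simp)
  let V : ℕ → LInfty := fun j => ⟨v j, hM.1 (hvM j)⟩
  have hVc : ∀ j, Integrable (((f - V j : LInfty) : L0) : Circle → ℂ) m := fun j =>
    (Lp.memLp (f - V j)).integrable le_top
  have hgl : Tendsto (fun j => gaugeExt α ((f - V j : LInfty) : L0)) atTop (𝓝 0) := by
    have h1 : Tendsto (fun j : ℕ => ((j : ℝ≥0∞) + 1)⁻¹) atTop (𝓝 0) := by
      have := (tendsto_add_atTop_iff_nat 1).2 ENNReal.tendsto_inv_nat_nhds_zero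
      simpa using this
    exact tendsto_of_tendsto_of_tendsto_of_le_of_le tendsto_const_nhds h1 (fun _ => zero_le)
      fun j => (hv j).le
  refine integral_eq_zero_of_approx (A' := fun j a => V j a * (q n a * g a)) (C := C)
    (integrable_mul_L1 f hint) (fun j => integrable_mul_L1 _ hint) (fun j => (hVc j).norm)
    (fun j => ?_) (tendsto_integral_norm_of_gaugeExt hα hVc hgl) fun j => hMq (V j) (hvM j)
  filter_upwards [hC, Lp.coeFn_sub f (V j)] with a h1 h2
  rw [h2, Pi.sub_apply, ← sub_mul, norm_mul, norm_mul (q n a), mul_comm, norm_sub_rev]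
  gcongr

/-- Otherwise separation for `u ↦ α(u f)` gives `G` in `L^1` that annihilates every bounded `u` with
`u f ∈ W`, in particular all polynomials, but not `h`. This contradicts
`integral_mul_eq_zero_of_poly_limit`. -/
theorem multiplier_mul_mem (hα : IsDominatingGauge α) (hc : IsContinuousGauge α)
    (W : Submodule ℂ L0) (hW : IsAlphaClosed α (W : Set L0)) (hzW : ∀ f ∈ W, z * f ∈ W)
    {f : L0} (hf : f ∈ W) {h : LInfty} {Q : ℕ → ℂ[X]}
    (hQ : Tendsto (fun i => ∫ a, ‖polyFun (Q i) a - h a‖ ∂m) atTop (𝓝 0)) :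
    (h : L0) * f ∈ W := by
  by_contra hhf
  have hfL := hW.1 hf
  obtain ⟨ε, hε, hd⟩ := exists_pos_le_gaugeExt hW (mul_mem_LAlpha hα hc h hfL) hhf
  have hfin := gaugeExt_lt_top hfL
  obtain ⟨G, hG, hGN, hGh⟩ := exists_annihilator_of_seminorm
    (isSolid_mulSeminorm hα hc f hfin) (isContinuousGauge_mulSeminorm hα hc hfL)
    (W.comap (mulL0 f)) hε (f := h) (by
      intro u hu
      have h1 : ENNReal.ofReal ε ≤ gaugeExt α ((h : L0) * f - (u : L0) * f) := hd _ hu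
      rw [← L0.sub_mul'] at h1
      have h2 : gaugeExt α (((h - u : LInfty) : L0) * f) = _ :=
        (ofReal_mulSeminorm hα hc f hfin (h - u)).symm
      have h3 : ENNReal.ofReal ε ≤ gaugeExt α (((h - u : LInfty) : L0) * f) := h1
      rw [h2] at h3
      exact (ENNReal.ofReal_le_ofReal_iff (apply_nonneg _ _)).1 h3)
  refine hGh (integral_mul_eq_zero_of_poly_limit hG (fun p => ?_) hQ)
  obtain ⟨C, hC⟩ := exists_bound_polyFun p
  let u : LInfty := mkInf (polyFun p) (continuous_polyFun p).aestronglyMeasurable C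
    (Eventually.of_forall hC)
  have hu : (u : L0) = polyL0 p := rfl
  have hmem : u ∈ W.comap (mulL0 f) := by
    have : (u : L0) * f ∈ W := hu ▸ polyL0_mul_mem hzW hf p
    exact this
  rw [← hGN u hmem]
  refine integral_congr_ae ?_
  filter_upwards [mkInf_coe (polyFun p) (continuous_polyFun p).aestronglyMeasurable C
    (Eventually.of_forall hC)] with a ha
  rw [ha]

theorem mem_alphaClosure_bounded (hα : IsDominatingGauge α) (hc : IsContinuousGauge α)
    (W : Submodule ℂ L0) (hW : IsAlphaClosed α (W : Set L0)) (hzW : ∀ f ∈ W, z * f ∈ W)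
    {f : L0} (hf : f ∈ W) : f ∈ alphaClosure α ((W : Set L0) ∩ linfSet) := by
  have hfL := hW.1 hf
  have hfin := gaugeExt_lt_top hfL
  have hfi := integrable_of_gaugeExt_lt_top hα hfin
  obtain ⟨q, hq1, hqb, hql, hqP⟩ := exists_multiplier_seq hfi.norm fun a => norm_nonneg _
  have hqW : ∀ n, (q n : L0) * f ∈ W := fun n => by
    obtain ⟨P, hPi, hPl⟩ := hqP n
    have hqn : Integrable (q n) m := (Lp.memLp (q n)).integrable le_top
    refine multiplier_mul_mem hα hc W hW hzW hf (Q := P) ?_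
    refine squeeze_zero (fun j => integral_nonneg fun a => norm_nonneg _) (fun j => ?_) hPl
    refine integral_mono ((integrable_polyFun (P j)).sub hqn).norm (hPi j) fun a => ?_
    exact le_mul_of_one_le_left (norm_nonneg _) (le_add_of_nonneg_right (norm_nonneg _))
  have hqI : ∀ n, (q n : L0) * f ∈ linfSet := fun n => by
    obtain ⟨C, hC⟩ := hqb n
    refine mem_linfSet_of_bound _ C ?_
    filter_upwards [AEEqFun.coeFn_mul (q n : L0) f, hC] with a h1 h2
    rw [h1, Pi.mul_apply, norm_mul]
    exact h2
  have hcoe : ∀ᵐ a ∂m, ∀ n, (chi MeasurableSet.univ - q n : LInfty) a = 1 - q n a := by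
    rw [ae_all_iff]
    intro n
    filter_upwards [Lp.coeFn_sub (chi MeasurableSet.univ) (q n), chi_univ_coe] with a h1 h2
    rw [h1, Pi.sub_apply, h2]
  -- The `α`-distance from `f` to `q n * f` is this seminorm of `1 - q n`, which is bounded by `2`
  -- and tends to `0` almost everywhere.
  have hlim : Tendsto (fun n => mulSeminorm hα hc f hfin (chi MeasurableSet.univ - q n)) atTop
      (𝓝 0) := by
    refine (isSolid_mulSeminorm hα hc f hfin).tendsto_zero
      (isContinuousGauge_mulSeminorm hα hc hfL) (C := 2) (fun n => ?_) ?_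
    · filter_upwards [hcoe, hq1 n] with a h1 h2
      rw [h1 n]
      have := norm_sub_le 1 (q n a)
      rw [norm_one] at this
      linarith
    · filter_upwards [hcoe, hql] with a h1 h2
      simp_rw [h1]
      simpa using h2.const_sub 1
  have hlim' : Tendsto (fun n => gaugeExt α (f - (q n : L0) * f)) atTop (𝓝 0) := by
    have e : ∀ n, gaugeExt α (f - (q n : L0) * f)
        = ENNReal.ofReal (mulSeminorm hα hc f hfin (chi MeasurableSet.univ - q n)) := fun n => by
      rw [ofReal_mulSeminorm]
      congr 1
      apply AEEqFun.ext
      filter_upwards [AEEqFun.coeFn_sub f ((q n : L0) * f), AEEqFun.coeFn_mul (q n : L0) f,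
        AEEqFun.coeFn_mul ((chi MeasurableSet.univ - q n : LInfty) : L0) f, hcoe]
        with a h1 h2 h3 h4
      rw [h1, h3, Pi.sub_apply, Pi.mul_apply, h2, Pi.mul_apply, h4 n]
      ring
    simp_rw [e]
    simpa using ENNReal.tendsto_ofReal hlim
  refine ⟨hfL, fun ε hε => ?_⟩
  obtain ⟨n, hn⟩ := (hlim'.eventually (gt_mem_nhds hε)).exists
  exact ⟨(q n : L0) * f, ⟨hqW n, hqI n⟩, hn⟩

end Main

end GaugeNorm

end

theorem theorem3p4
    (α : Seminorm ℂ GaugeNorm.LInfty)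
    (hα : GaugeNorm.IsDominatingGauge α) (hcont : GaugeNorm.IsContinuousGauge α)
    (W M : Submodule ℂ GaugeNorm.L0)
    (hW : GaugeNorm.IsAlphaClosed α (W : Set GaugeNorm.L0))
    (hM : GaugeNorm.IsWeakStarClosed (M : Set GaugeNorm.L0))
    (hzW : ∀ f ∈ W, GaugeNorm.z * f ∈ W)
    (hzM : ∀ f ∈ M, GaugeNorm.z * f ∈ M) :
    (M : Set GaugeNorm.L0)
        = GaugeNorm.alphaClosure α (M : Set GaugeNorm.L0) ∩ GaugeNorm.linfSet ∧
    GaugeNorm.IsWeakStarClosed ((W : Set GaugeNorm.L0) ∩ (M : Set GaugeNorm.L0)) ∧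
    (W : Set GaugeNorm.L0)
        = GaugeNorm.alphaClosure α ((W : Set GaugeNorm.L0) ∩ GaugeNorm.linfSet) := by
  refine ⟨Set.Subset.antisymm (fun f hf => ⟨⟨?_, fun ε hε => ⟨f, hf, ?_⟩⟩, hM.1 hf⟩) ?_,
    ⟨fun f hf => hM.1 hf.2, ?_⟩, Set.Subset.antisymm ?_ ?_⟩
  · exact GaugeNorm.linfSet_subset_LAlpha hα hcont (hM.1 hf)
  · rwa [sub_self, GaugeNorm.gaugeExt_zero hα hcont]
  · rintro f ⟨hf, hfI⟩
    exact GaugeNorm.mem_of_mem_alphaClosure hα M hM hzM ⟨f, hfI⟩ hf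
  -- As a subset of `L^∞`, `W ∩ M` is the intersection of the weak*-closed sets `W ∩ L^∞` and `M`.
  · exact @IsClosed.inter _ _ _ GaugeNorm.weakStar
      (GaugeNorm.isClosed_comap_inclL0 hα hcont W hW) hM.2
  · exact fun f hf => GaugeNorm.mem_alphaClosure_bounded hα hcont W hW hzW hf
  · rintro f ⟨hfL, hf⟩
    refine hW.2 ⟨hfL, fun ε hε => ?_⟩
    obtain ⟨g, hg, hfg⟩ := hf ε hε
    exact ⟨g, hg.1, hfg⟩
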